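/- Let $\mathbb A^2=\mathbb R^2$ be the affine plane with its group $\mathrm{Aff}(2)$ of invertible affine transformations. A flat affine surface is a surface with an atlas of charts in $\mathbb A^2$ whose coordinate changes are locally restrictions of elements of $\mathrm{Aff}(2)$; a map between flat affine surfaces is a local affine diffeomorphism if in local charts it coincides with elements of $\mathrm{Aff}(2)$, and an affine diffeomorphism if it is moreover a homeomorphism. Let $\mathcal H=\{y>0\}$ and $\mathcal Q=\{x>0,\ y>0\}$ be the open half-plane and the open quadrant in $\mathbb A^2$, and let $\widetilde{\mathbb A^2\setminus 0}$ be the universal covering space of the once punctured plane $\mathbb A^2\setminus\{0\}$, with the flat affine structure pulled back by the covering projection. An affine homogeneous domain is a non-empty connected open subset of $\mathbb A^2$ on which the group of affine transformations preserving it acts transitively. Let $M$ be a flat affine two-torus, i.e. a flat affine surface homeomorphic to the torus $S^1\times S^1$. Then at least one of the following holds. 1. There is a simply connected affine homogeneous domain $\Omega\subseteq\mathbb A^2$, which is one of $\mathbb A^2$, $\mathcal H$, $\mathcal Q$, and a group $\Gamma$ of affine transformations preserving $\Omega$ and acting properly discontinuously and freely on $\Omega$, such that $M$ is affinely diffeomorphic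 to $\Omega/\Gamma$. In this case the universal covering flat affine surface of $M$ is affinely diffeomorphic to $\Omega$. 2. There is a group $\Gamma$ of affine diffeomorphisms of $\widetilde{\mathbb A^2\setminus 0}$, acting properly discontinuously and freely, such that $M$ is affinely diffeomorphic to $\widetilde{\mathbb A^2\setminus 0}\,/\,\Gamma$. In this case the universal covering flat affine surface of $M$ is affinely diffeomorphic to $\widetilde{\mathbb A^2\setminus 0}$. In particular, the universal covering flat affine surface of $M$ is affinely diffeomorphic to $\mathbb A^2$, $\mathcal H$, $\mathcal Q$ or $\widetilde{\mathbb A^2\setminus 0}$. -/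

import Mathlib

open Set Filter Topology TopologicalSpace

universe u v w

noncomputable section

/-- The affine plane `𝔸² = ℝ²`. -/
abbrev AffPlane : Type := EuclideanSpace ℝ (Fin 2)

attribute [instance 2000] chartedSpaceSelf TopologicalSpace.Opens.instChartedSpace
  MulAction.instChartedSpaceQuotient

/-- Maps of the plane which, near each point of `u`, agree with an invertible affine
transformation of `ℝ²`. -/
def affPregroupoid : Pregroupoid AffPlane where
  property f u := ∀ x ∈ u, ∃ A : AffPlane ≃ᵃ[ℝ] AffPlane, f =ᶠ[𝓝 x] A
  comp := by
    rintro f g u v hf hg - - - x ⟨hxu, hxv⟩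
    obtain ⟨A, hA⟩ := hf x hxu
    obtain ⟨B, hB⟩ := hg (f x) hxv
    refine ⟨A.trans B, ?_⟩
    have hc : Tendsto f (𝓝 x) (𝓝 (f x)) := by
      have h1 : Continuous A := A.toAffineMap.continuous_of_finiteDimensional
      have h2 : ContinuousAt f x := h1.continuousAt.congr hA.symm
      exact h2
    filter_upwards [hA, hc.eventually hB] with y h1 h2
    simp only [Function.comp_apply, AffineEquiv.trans_apply]
    rw [h2, h1]
  id_mem := fun x _ => ⟨AffineEquiv.refl ℝ AffPlane, by
    filter_upwards with y; simp⟩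
  locality := by
    intro f u _ h x hx
    obtain ⟨v, _, hxv, hv⟩ := h x hx
    exact hv x ⟨hx, hxv⟩
  congr := by
    intro f g u hu hfg hf x hx
    obtain ⟨A, hA⟩ := hf x hx
    refine ⟨A, ?_⟩
    filter_upwards [hA, hu.mem_nhds hx] with y h1 h2
    rw [hfg y h2, h1]

/-- The pseudogroup of local homeomorphisms of the plane that are locally restrictions of elements
of `Aff(2)`. A flat affine surface is a space `M` with `[ChartedSpace AffPlane M]` and
`[HasGroupoid M affGroupoid]`; an affine diffeomorphism is a `Structomorph affGroupoid`. -/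
def affGroupoid : StructureGroupoid AffPlane := affPregroupoid.groupoid

/-- A map between flat affine surfaces that coincides, in the local charts, with an element of
`Aff(2)`, i.e. a local affine diffeomorphism. -/
def IsAffMap {N M : Type*} [TopologicalSpace N] [ChartedSpace AffPlane N]
    [TopologicalSpace M] [ChartedSpace AffPlane M] (f : N → M) : Prop :=
  Continuous f ∧ ∀ x : N, ∃ A : AffPlane ≃ᵃ[ℝ] AffPlane,
    (fun y => chartAt AffPlane (f x) (f y)) =ᶠ[𝓝 x] fun y => A (chartAt AffPlane x y)

/-- `q : N → M` exhibits `N` as the universal covering flat affine surface of `M`. -/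
structure IsUniversalAffCovering {N M : Type*} [TopologicalSpace N] [ChartedSpace AffPlane N]
    [TopologicalSpace M] [ChartedSpace AffPlane M] (q : N → M) : Prop where
  simplyConnected : SimplyConnectedSpace N
  isCoveringMap : IsCoveringMap q
  surjective : Function.Surjective q
  isAffMap : IsAffMap q

/-- The universal covering flat affine surface of `M` is affinely diffeomorphic to `X`: there is
a universal affine covering `X → M`, and every flat affine surface `N` which is the source of a
universal affine covering of `M` is affinely diffeomorphic to `X`. -/
def UniversalAffCoverIs (M : Type u) [TopologicalSpace M] [ChartedSpace AffPlane M]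
    (X : Type v) [TopologicalSpace X] [ChartedSpace AffPlane X] : Prop :=
  (∃ p : X → M, IsUniversalAffCovering p) ∧
  ∀ (N : Type w) [TopologicalSpace N] [ChartedSpace AffPlane N] [HasGroupoid N affGroupoid]
    (q : N → M), IsUniversalAffCovering q → Nonempty (Structomorph affGroupoid N X)

/-! ### Quotients by properly discontinuous groups -/

/-- The tautological action of the homeomorphism group. -/
instance homeomorphMulAction (X : Type*) [TopologicalSpace X] : MulAction (X ≃ₜ X) X where
  smul g x := g x
  one_smul _ := rfl
  mul_smul _ _ _ := rfl

instance homeomorphContinuousConstSMul (X : Type*) [TopologicalSpace X] :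
    ContinuousConstSMul (X ≃ₜ X) X where
  continuous_const_smul g := g.continuous

instance homeomorphSubgroupContinuousConstSMul (X : Type*) [TopologicalSpace X]
    (Γ : Subgroup (X ≃ₜ X)) : ContinuousConstSMul Γ X where
  continuous_const_smul g := g.1.continuous

instance opensAffPlaneLocallyCompact (U : Opens AffPlane) : LocallyCompactSpace U :=
  U.isOpen.locallyCompactSpace

/-- `Γ` acts properly discontinuously and freely on `X`, and `M` is affinely diffeomorphic to the
quotient `X / Γ`, where the charts of `X / Γ` are the charts of `X` composed with local inverses
of the projection `X → X / Γ`. -/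
def IsAffQuotientBy (M X : Type*) [TopologicalSpace M] [ChartedSpace AffPlane M]
    [TopologicalSpace X] [T2Space X] [LocallyCompactSpace X] [ChartedSpace AffPlane X]
    (Γ : Subgroup (X ≃ₜ X)) : Prop :=
  ∃ (_ : ProperlyDiscontinuousSMul Γ X) (_ : IsCancelSMul Γ X),
    Nonempty (Structomorph affGroupoid M (MulAction.orbitRel.Quotient Γ X))

/-! ### Affine domains -/

/-- An affine homogeneous domain: a non-empty connected open subset of the plane on which the
affine transformations preserving it act transitively. -/
def IsHomogeneousAffDomain (Ω : Opens AffPlane) : Prop :=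
  IsConnected (Ω : Set AffPlane) ∧
  ∀ x ∈ Ω, ∀ y ∈ Ω, ∃ A : AffPlane ≃ᵃ[ℝ] AffPlane,
    A '' (Ω : Set AffPlane) = Ω ∧ A x = y

/-- The homeomorphism `γ` of the domain `Ω` is the restriction of an affine transformation. -/
def IsAffTransformationOf (Ω : Opens AffPlane) (γ : Ω ≃ₜ Ω) : Prop :=
  ∃ A : AffPlane ≃ᵃ[ℝ] AffPlane, ∀ x : Ω, (γ x : AffPlane) = A x

/-- The open half-plane `y > 0`. -/
def affHalfPlane : Opens AffPlane where
  carrier := {p | 0 < p 1}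
  is_open' := isOpen_lt continuous_const (by fun_prop)

/-- The open sector (quadrant) `x > 0, y > 0`. -/
def affQuadrant : Opens AffPlane where
  carrier := {p | 0 < p 0 ∧ 0 < p 1}
  is_open' := by
    have h0 : IsOpen {p : AffPlane | 0 < p 0} := isOpen_lt continuous_const (by fun_prop)
    have h1 : IsOpen {p : AffPlane | 0 < p 1} := isOpen_lt continuous_const (by fun_prop)
    exact h0.inter h1

/-! ### The universal covering of the once punctured plane -/

/-- The total space of the universal covering of the once punctured plane, in logarithmic polar
coordinates `(s, θ)`. -/
def PuncturedPlaneCover : Type := ℝ × ℝ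

namespace PuncturedPlaneCover

instance : TopologicalSpace PuncturedPlaneCover := inferInstanceAs (TopologicalSpace (ℝ × ℝ))
instance : T2Space PuncturedPlaneCover := inferInstanceAs (T2Space (ℝ × ℝ))
instance : LocallyCompactSpace PuncturedPlaneCover :=
  inferInstanceAs (LocallyCompactSpace (ℝ × ℝ))
instance : SimplyConnectedSpace PuncturedPlaneCover :=
  inferInstanceAs (SimplyConnectedSpace (ℝ × ℝ))

/-- `(s, θ) ↦ (eˢ cos θ, eˢ sin θ)`. -/
def dev (x : PuncturedPlaneCover) : AffPlane :=
  !₂[Real.exp x.1 * Real.cos x.2, Real.exp x.1 * Real.sin x.2]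

/-- The coordinate `s + iθ`. -/
def toComplex : PuncturedPlaneCover ≃ₜ ℂ := Complex.equivRealProdCLM.symm.toHomeomorph

theorem dev_eq (x : PuncturedPlaneCover) :
    dev x = Complex.orthonormalBasisOneI.repr (Complex.exp (toComplex x)) := by
  have h0 : (toComplex x).re = x.1 := rfl
  have h1 : (toComplex x).im = x.2 := rfl
  ext i
  fin_cases i <;> simp [dev, Complex.exp_re, Complex.exp_im, h0, h1]

theorem dev_ne_zero (x : PuncturedPlaneCover) : dev x ≠ 0 := by
  rw [dev_eq]
  simp

/-- The universal covering projection onto the once punctured plane. -/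
def proj (x : PuncturedPlaneCover) : {p : AffPlane // p ≠ 0} := ⟨dev x, dev_ne_zero x⟩

/-- Identification of `ℂ ∖ {0}` with the punctured plane. -/
def puncturedHomeo : {z : ℂ // z ≠ 0} ≃ₜ {p : AffPlane // p ≠ 0} :=
  Complex.orthonormalBasisOneI.repr.toHomeomorph.subtype (by intro z; simp)

theorem proj_eq : proj = (puncturedHomeo ∘ fun z : ℂ => ⟨Complex.exp z, z.exp_ne_zero⟩) ∘
    toComplex :=
  funext fun x => Subtype.ext (dev_eq x)

theorem isCoveringMap_proj : IsCoveringMap proj := by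
  rw [proj_eq]
  exact (Complex.isCoveringMap_exp.homeomorph_comp puncturedHomeo).comp_homeomorph toComplex

theorem surjective_proj : Function.Surjective proj := by
  rw [proj_eq]
  refine (puncturedHomeo.surjective.comp fun z => ?_).comp toComplex.surjective
  exact ⟨Complex.log z, Subtype.ext (Complex.exp_log z.2)⟩

theorem isLocalHomeomorph_dev : IsLocalHomeomorph dev :=
  (isOpen_compl_singleton (x := (0 : AffPlane))).isOpenEmbedding_subtypeVal.isLocalHomeomorph.comp
    isCoveringMap_proj.isLocalHomeomorph

/-- The flat affine structure pulled back from the punctured plane: its charts are the local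
restrictions of `dev`. -/
instance : ChartedSpace AffPlane PuncturedPlaneCover where
  atlas := {e | ∀ x ∈ e.source, e x = dev x}
  chartAt x := (isLocalHomeomorph_dev x).choose
  mem_chart_source x := (isLocalHomeomorph_dev x).choose_spec.1
  chart_mem_atlas x := fun y _ => (congrFun (isLocalHomeomorph_dev x).choose_spec.2 y).symm

instance : HasGroupoid PuncturedPlaneCover affGroupoid where
  compatible := by
    have key : ∀ e e' : OpenPartialHomeomorph PuncturedPlaneCover AffPlane,
        (∀ x ∈ e.source, e x = dev x) → (∀ x ∈ e'.source, e' x = dev x) →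
        affPregroupoid.property (e.symm.trans e') (e.symm.trans e').source := by
      intro e e' he he' x hx
      refine ⟨AffineEquiv.refl ℝ AffPlane, ?_⟩
      filter_upwards [(e.symm.trans e').open_source.mem_nhds hx] with y hy
      rw [OpenPartialHomeomorph.trans_source] at hy
      have h1 : e.symm y ∈ e'.source := hy.2
      have h2 : y ∈ e.target := hy.1
      have h3 : e.symm y ∈ e.source := e.map_target h2
      simp only [OpenPartialHomeomorph.coe_trans, Function.comp_apply, AffineEquiv.refl_apply]
      rw [he' _ h1, ← he _ h3, e.right_inv h2]
    intro e e' he he'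
    exact ⟨key e e' he he', key e' e he' he⟩

end PuncturedPlaneCover

end

/-! ### Germs of plane-valued maps modulo affine transformations -/

/-! Pull the affine structure back along the covering `q : ℝ × ℝ → M`. The plane is simply
connected, so the local charts glue to a developing map `D`, a local homeomorphism into the affine
plane which intertwines the lattice translations with commuting affine maps, the holonomy `h`.
Everything reduces to determining the image and the injectivity of `D` (`IsTorusDev.isStandardDev`).

Commuting affine maps of the plane have a common fixed point, or their linear parts have a common
nonzero fixed vector (`exists_fixed_point_or_vector`). In either case a one-parameter group commutes
with the holonomy: homotheties about the point, or translations along the vector. By cocompactness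
its flow lifts through `D` for a uniform time, hence for all time (`exists_lift_flow`). A local
homeomorphism from a connected surface to `ℝ × ℝ` through which the horizontal flow lifts is an
embedding onto a strip `ℝ × J`, with `J` an open interval
(`injective_and_range_of_horizontal_flow`).

With a fixed vector this applies to `D` itself, and the holonomy acts on `J` by affine maps of the
line. A common fixed height cannot lie in `J`, because a rank two lattice would then act by
translations on a single line with arbitrarily small steps (`not_latticeShift_preserves_line`). So
`J` is a half-line or the whole line; the remaining possibility, a trivial action on `J`,
contradicts compactness of the torus.

With a fixed point, `D` avoids that point (`IsTorusDev.ne_zero`) and the strip theorem applies to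
its lift to logarithmic polar coordinates; now `J` is an interval of angles. If `J` is bounded on
one side, its length is at most `π`, since otherwise the angle at distance `π` from that end would
be an invariant line of the same forbidden kind. The image of `D` is then a half-plane or a sector
affinely equivalent to the quadrant. If `J` is all of `ℝ`, the lift is a homeomorphism onto the
universal covering of the punctured plane. -/

theorem AffineEquiv.continuous_affPlane (A : AffPlane ≃ᵃ[ℝ] AffPlane) : Continuous A :=
  A.toAffineMap.continuous_of_finiteDimensional

/-- Near `x`, the plane-valued maps `φ` and `ψ` differ by an affine transformation. -/
def AffGerm {N : Type*} [TopologicalSpace N] (φ ψ : N → AffPlane) (x : N) : Prop :=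
  ∃ A : AffPlane ≃ᵃ[ℝ] AffPlane, φ =ᶠ[𝓝 x] fun y => A (ψ y)

namespace AffGerm

variable {N M : Type*} [TopologicalSpace N] [TopologicalSpace M]

theorem of_eventuallyEq {φ ψ : N → AffPlane} {x : N} (h : φ =ᶠ[𝓝 x] ψ) : AffGerm φ ψ x :=
  ⟨AffineEquiv.refl ℝ AffPlane, by filter_upwards [h] with y hy; simpa using hy⟩

theorem of_apply (A : AffPlane ≃ᵃ[ℝ] AffPlane) (ψ : N → AffPlane) (x : N) :
    AffGerm (fun y => A (ψ y)) ψ x :=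
  ⟨A, EventuallyEq.rfl⟩

theorem symm {φ ψ : N → AffPlane} {x : N} (h : AffGerm φ ψ x) : AffGerm ψ φ x := by
  obtain ⟨A, hA⟩ := h
  refine ⟨A.symm, ?_⟩
  filter_upwards [hA] with y hy
  simp [hy]

theorem trans {φ ψ χ : N → AffPlane} {x : N} (h : AffGerm φ ψ x) (h' : AffGerm ψ χ x) :
    AffGerm φ χ x := by
  obtain ⟨A, hA⟩ := h
  obtain ⟨B, hB⟩ := h'
  refine ⟨B.trans A, ?_⟩
  filter_upwards [hA, hB] with y h1 h2
  simp [h1, h2]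

theorem comp {φ ψ : M → AffPlane} {f : N → M} {x : N} (h : AffGerm φ ψ (f x))
    (hf : ContinuousAt f x) : AffGerm (fun y => φ (f y)) (fun y => ψ (f y)) x := by
  obtain ⟨A, hA⟩ := h
  exact ⟨A, hf.eventually hA⟩

/-- An open map sends neighbourhoods of `x` to neighbourhoods of `f x`. This allows germs on a
quotient to be compared upstairs. -/
theorem of_comp {φ ψ : M → AffPlane} {f : N → M} {x : N} (hf : IsOpenMap f)
    (h : AffGerm (fun y => φ (f y)) (fun y => ψ (f y)) x) : AffGerm φ ψ (f x) := by
  obtain ⟨A, hA⟩ := h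
  exact ⟨A, hf.nhds_le x (eventually_map.2 hA)⟩

end AffGerm

/-- Any two charts of a flat affine surface differ locally by affine transformations. -/
theorem affGerm_of_mem_atlas {M : Type*} [TopologicalSpace M] [ChartedSpace AffPlane M]
    [HasGroupoid M affGroupoid] {c c' : OpenPartialHomeomorph M AffPlane}
    (hc : c ∈ atlas AffPlane M) (hc' : c' ∈ atlas AffPlane M) {x : M} (hx : x ∈ c.source)
    (hx' : x ∈ c'.source) : AffGerm c c' x := by
  have h := mem_groupoid_of_pregroupoid.1 (affGroupoid.compatible hc' hc)
  obtain ⟨A, hA⟩ := h.1 (c' x) (by simp [hx, hx'])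
  refine ⟨A, ?_⟩
  filter_upwards [(c'.continuousAt hx').eventually hA, c'.open_source.mem_nhds hx'] with y hy hys
  simpa [hys] using hy

/-- A homeomorphism which is affine in all charts is an affine diffeomorphism. -/
def structomorphOfAffGerm {M N : Type*} [TopologicalSpace M] [ChartedSpace AffPlane M]
    [TopologicalSpace N] [ChartedSpace AffPlane N] (f : M ≃ₜ N)
    (hf : ∀ c ∈ atlas AffPlane M, ∀ c' ∈ atlas AffPlane N, ∀ x ∈ c.source, f x ∈ c'.source →
      AffGerm (fun y => c' (f y)) c x) : Structomorph affGroupoid M N :=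
  { f with
    mem_groupoid := by
      intro c c' hc hc'
      refine mem_groupoid_of_pregroupoid.2 ⟨fun z hz => ?_, fun z hz => ?_⟩
      · simp only [OpenPartialHomeomorph.trans_source, OpenPartialHomeomorph.symm_source,
          Homeomorph.toOpenPartialHomeomorph_source, mem_inter_iff, mem_preimage, mem_univ,
          true_and] at hz
        obtain ⟨A, hA⟩ := hf c hc c' hc' (c.symm z) (c.map_target hz.1) hz.2
        refine ⟨A, ?_⟩
        filter_upwards [(c.continuousAt_symm hz.1).eventually hA, c.open_target.mem_nhds hz.1]
          with y hy hy'
        simpa [hy'] using hy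
      · simp only [OpenPartialHomeomorph.trans_target, OpenPartialHomeomorph.symm_target,
          Homeomorph.toOpenPartialHomeomorph_target, mem_inter_iff, mem_preimage, mem_univ,
          OpenPartialHomeomorph.coe_trans, Function.comp_apply,
          OpenPartialHomeomorph.trans_symm_eq_symm_trans_symm, preimage_univ] at hz
        have hz1 : z ∈ c'.target := hz.1.1
        have hz2 : f.symm (c'.symm z) ∈ c.source := hz.2
        have h1 := (hf c hc c' hc' (f.symm (c'.symm z)) hz2
          (by simpa using c'.map_target hz1)).symm
        have h2 : AffGerm (fun y => c (f.symm y)) (fun y => c' (f (f.symm y))) (c'.symm z) :=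
          h1.comp f.symm.continuous.continuousAt
        obtain ⟨A, hA⟩ := h2
        refine ⟨A, ?_⟩
        filter_upwards [(c'.continuousAt_symm hz1).eventually hA, c'.open_target.mem_nhds hz1]
          with y hy hyt
        simpa [hyt] using hy }

/-! ### Surfaces with a global developing map -/

/-- The charts of `X` are the local restrictions of the map `δ`, up to affine transformations. -/
def IsDevelopingMap (X : Type*) [TopologicalSpace X] [ChartedSpace AffPlane X]
    (δ : X → AffPlane) : Prop :=
  ∀ c ∈ atlas AffPlane X, ∀ x ∈ c.source, AffGerm c δ x

theorem isDevelopingMap_subtypeVal (Ω : Opens AffPlane) :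
    IsDevelopingMap Ω (Subtype.val : Ω → AffPlane) := by
  intro c hc x hx
  obtain ⟨y, hy⟩ := mem_iUnion.1 hc
  have hy : c = (chartAt AffPlane y.1).subtypeRestr ⟨y⟩ := hy
  subst hy
  refine AffGerm.of_eventuallyEq ?_
  filter_upwards with z
  rfl

theorem PuncturedPlaneCover.isDevelopingMap_dev :
    IsDevelopingMap PuncturedPlaneCover PuncturedPlaneCover.dev := by
  intro c hc x hx
  refine AffGerm.of_eventuallyEq ?_
  filter_upwards [c.open_source.mem_nhds hx] with y hy
  exact hc y hy

/-! ### The universal covering of the torus by the plane -/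

/-- The translation of `ℝ × ℝ` by `2π γ`. -/
noncomputable def latticeShift (γ : ℤ × ℤ) : ℝ × ℝ ≃ₜ ℝ × ℝ :=
  Homeomorph.addRight ((2 * Real.pi * γ.1, 2 * Real.pi * γ.2) : ℝ × ℝ)

theorem latticeShift_apply (γ : ℤ × ℤ) (x : ℝ × ℝ) :
    latticeShift γ x = (x.1 + 2 * Real.pi * γ.1, x.2 + 2 * Real.pi * γ.2) := rfl

theorem latticeShift_add (γ γ' : ℤ × ℤ) (x : ℝ × ℝ) :
    latticeShift (γ + γ') x = latticeShift γ (latticeShift γ' x) := by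
  simp only [latticeShift_apply, Prod.fst_add, Prod.snd_add, Int.cast_add]
  ext <;> simp <;> ring

theorem latticeShift_zero (x : ℝ × ℝ) : latticeShift 0 x = x := by
  simp [latticeShift_apply]

theorem latticeShift_eq_self {γ : ℤ × ℤ} {x : ℝ × ℝ} (h : latticeShift γ x = x) : γ = 0 := by
  rw [latticeShift_apply] at h
  have h1 := congrArg Prod.fst h
  have h2 := congrArg Prod.snd h
  simp [Real.pi_ne_zero] at h1 h2
  exact Prod.ext h1 h2

/-- `q` is the quotient map of the plane by the lattice `2πℤ²`. -/
structure IsTorusCover {M : Type*} [TopologicalSpace M] (q : ℝ × ℝ → M) : Prop where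
  isLocalHomeomorph : IsLocalHomeomorph q
  surjective : Function.Surjective q
  eq_iff : ∀ x y, q x = q y ↔ ∃ γ, y = latticeShift γ x

theorem IsLocalHomeomorph.prodMap {X Y X' Y' : Type*} [TopologicalSpace X] [TopologicalSpace Y]
    [TopologicalSpace X'] [TopologicalSpace Y'] {f : X → Y} {g : X' → Y'}
    (hf : IsLocalHomeomorph f) (hg : IsLocalHomeomorph g) : IsLocalHomeomorph (Prod.map f g) := by
  intro x
  obtain ⟨e, he, rfl⟩ := hf x.1
  obtain ⟨e', he', rfl⟩ := hg x.2
  exact ⟨e.prod e', ⟨he, he'⟩, rfl⟩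

theorem exists_isTorusCover {M : Type*} [TopologicalSpace M] (e : M ≃ₜ Circle × Circle) :
    ∃ q : ℝ × ℝ → M, IsTorusCover q := by
  refine ⟨e.symm ∘ Prod.map Circle.exp Circle.exp, ?_, ?_, ?_⟩
  · exact e.symm.isLocalHomeomorph.comp
      (isLocalHomeomorph_circleExp.prodMap isLocalHomeomorph_circleExp)
  · refine e.symm.surjective.comp (Function.Surjective.prodMap ?_ ?_) <;>
    exact Circle.isAddQuotientCoveringMap_exp.surjective
  · rintro ⟨x₁, x₂⟩ ⟨y₁, y₂⟩
    simp only [Function.comp_apply, e.symm.injective.eq_iff, Prod.map_apply, Prod.mk.injEq,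
      Circle.exp_eq_exp]
    constructor
    · rintro ⟨⟨m, hm⟩, n, hn⟩
      refine ⟨(-m, -n), ?_⟩
      rw [latticeShift_apply]
      ext <;> simp [hm, hn] <;> ring
    · rintro ⟨γ, h⟩
      rw [latticeShift_apply, Prod.mk.injEq] at h
      rw [h.1, h.2]
      exact ⟨⟨-γ.1, by simp; ring⟩, -γ.2, by simp; ring⟩

/-- Every point is equivalent to one of a fixed compact square. -/
theorem exists_latticeShift_mem_Icc (x : ℝ × ℝ) :
    ∃ γ, latticeShift γ x ∈ Icc (0 : ℝ × ℝ) (2 * Real.pi, 2 * Real.pi) := by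
  have key : ∀ a : ℝ, ∃ n : ℤ, 0 ≤ a + 2 * Real.pi * n ∧ a + 2 * Real.pi * n ≤ 2 * Real.pi := by
    intro a
    refine ⟨-⌊a / (2 * Real.pi)⌋, ?_⟩
    have hpi := Real.two_pi_pos
    have h1 := Int.floor_le (a / (2 * Real.pi))
    have h2 := (Int.lt_floor_add_one (a / (2 * Real.pi))).le
    rw [le_div_iff₀ hpi] at h1
    rw [div_le_iff₀ hpi] at h2
    push_cast
    constructor <;> linarith
  obtain ⟨m, hm, hm'⟩ := key x.1
  obtain ⟨n, hn, hn'⟩ := key x.2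
  exact ⟨(m, n), ⟨hm, hn⟩, ⟨hm', hn'⟩⟩

theorem latticeShift_finite {K L : Set (ℝ × ℝ)} (hK : IsCompact K) (hL : IsCompact L) :
    {γ : ℤ × ℤ | ((latticeShift γ) '' K ∩ L).Nonempty}.Finite := by
  obtain ⟨R, hR⟩ := hK.isBounded.exists_norm_le
  obtain ⟨S, hS⟩ := hL.isBounded.exists_norm_le
  have hpi := Real.pi_gt_three
  obtain ⟨B, hB⟩ := exists_nat_ge (R + S)
  -- Each coordinate satisfies `2π|n| ≤ R + S ≤ B`, and `2π > 1`, so the integer is at most `B` in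
  -- absolute value.
  refine (Set.finite_Icc ((-B, -B) : ℤ × ℤ) (B, B)).subset ?_
  rintro γ ⟨-, ⟨x, hx, rfl⟩, hy⟩
  have h1 := hR x hx
  have h2 := hS _ hy
  rw [latticeShift_apply] at h2
  simp only [Prod.norm_def, sup_le_iff, Real.norm_eq_abs, abs_le] at h1 h2
  have key : ∀ (a : ℝ) (n : ℤ), -R ≤ a → a ≤ R → -S ≤ a + 2 * Real.pi * n →
      a + 2 * Real.pi * n ≤ S → -(B : ℤ) ≤ n ∧ n ≤ B := by
    intro a n h1 h2 h3 h4
    constructor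
    · by_contra h
      have h : (n : ℝ) ≤ -(B : ℝ) - 1 := by
        have : n ≤ -(B : ℤ) - 1 := by omega
        exact_mod_cast this
      nlinarith
    · by_contra h
      have h : (B : ℝ) + 1 ≤ n := by
        have : (B : ℤ) + 1 ≤ n := by omega
        exact_mod_cast this
      nlinarith
  have k1 := key _ _ h1.1.1 h1.1.2 h2.1.1 h2.1.2
  have k2 := key _ _ h1.2.1 h1.2.2 h2.2.1 h2.2.2
  exact ⟨⟨k1.1, k2.1⟩, ⟨k1.2, k2.2⟩⟩

/-! ### The lattice as a free, properly discontinuous group on a model space -/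

section Quotient

variable {X : Type*} [TopologicalSpace X]

/-- The lattice translations, transported to `X` by a homeomorphism. -/
noncomputable def deckGroup (F : ℝ × ℝ ≃ₜ X) : Subgroup (X ≃ₜ X) where
  carrier := {g | ∃ γ, g = F.symm.trans ((latticeShift γ).trans F)}
  mul_mem' := by
    rintro _ _ ⟨γ, rfl⟩ ⟨γ', rfl⟩
    refine ⟨γ + γ', ?_⟩
    ext x
    simp [latticeShift_add]
  one_mem' := ⟨0, by ext x; simp [latticeShift_zero]⟩
  inv_mem' := by
    rintro _ ⟨γ, rfl⟩
    refine ⟨-γ, ?_⟩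
    rw [inv_eq_iff_mul_eq_one]
    ext x
    simp [← latticeShift_add, latticeShift_zero]

theorem deckGroup_apply {F : ℝ × ℝ ≃ₜ X} {g : X ≃ₜ X} (hg : g ∈ deckGroup F) :
    ∃ γ, ∀ x, g (F x) = F (latticeShift γ x) := by
  obtain ⟨γ, rfl⟩ := hg
  exact ⟨γ, fun x => by simp⟩

theorem properlyDiscontinuousSMul_deckGroup (F : ℝ × ℝ ≃ₜ X) :
    ProperlyDiscontinuousSMul (deckGroup F) X where
  finite_disjoint_inter_image := by
    intro K L hK hL
    have hfin := latticeShift_finite (hK.image F.symm.continuous) (hL.image F.symm.continuous)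
    have : ∀ g : deckGroup F, ∃ γ, (g : X ≃ₜ X) = F.symm.trans ((latticeShift γ).trans F) :=
      fun g => g.2
    choose γ hγ using this
    refine Set.Finite.of_finite_image (f := γ) (hfin.subset ?_) ?_
    · rintro _ ⟨g, hg, rfl⟩
      obtain ⟨-, ⟨x, hx, rfl⟩, hy⟩ := hg
      refine ⟨latticeShift (γ g) (F.symm x), ⟨_, ⟨x, hx, rfl⟩, rfl⟩, ⟨_, hy, ?_⟩⟩
      have : g • x = (g : X ≃ₜ X) x := rfl
      change F.symm (g • x) = _
      rw [this, hγ g]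
      simp
    · intro g _ g' _ h
      apply Subtype.ext
      rw [hγ g, hγ g', h]

theorem isCancelSMul_deckGroup (F : ℝ × ℝ ≃ₜ X) : IsCancelSMul (deckGroup F) X := by
  refine isCancelSMul_iff_eq_one_of_smul_eq.2 ?_
  rintro ⟨_, γ, rfl⟩ x hx
  have h : F (latticeShift γ (F.symm x)) = x := hx
  have h0 : γ = 0 := latticeShift_eq_self (x := F.symm x) (F.eq_symm_apply.2 h)
  subst h0
  apply Subtype.ext
  ext y
  simp [latticeShift_zero]

end Quotient

/-! ### From a developing homeomorphism to the quotient and the universal covering -/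

section Assembly

theorem orbitRel_deckGroup_iff {M X : Type*} [TopologicalSpace M] [TopologicalSpace X]
    {q : ℝ × ℝ → M} (hq : IsTorusCover q) (F : ℝ × ℝ ≃ₜ X) (x y : X) :
    q (F.symm x) = q (F.symm y) ↔ x ∈ MulAction.orbit (deckGroup F) y := by
  rw [eq_comm, hq.eq_iff]
  constructor
  · rintro ⟨γ, hγ⟩
    refine ⟨⟨_, γ, rfl⟩, ?_⟩
    change F (latticeShift γ (F.symm y)) = x
    simp [← hγ]
  · rintro ⟨⟨_, γ, rfl⟩, rfl⟩
    refine ⟨γ, ?_⟩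
    change F.symm (F (latticeShift γ (F.symm y))) = _
    simp

theorem isQuotientCoveringMap_comp_symm {M X : Type*} [TopologicalSpace M] [TopologicalSpace X]
    [T2Space X] [LocallyCompactSpace X] {q : ℝ × ℝ → M} (hq : IsTorusCover q) (F : ℝ × ℝ ≃ₜ X) :
    IsQuotientCoveringMap (q ∘ F.symm) (deckGroup F) := by
  have := properlyDiscontinuousSMul_deckGroup F
  have := isCancelSMul_deckGroup F
  have h := hq.isLocalHomeomorph.comp F.symm.isLocalHomeomorph
  exact (h.isOpenMap.isQuotientMap h.continuous (hq.surjective.comp F.symm.surjective)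
    ).isQuotientCoveringMap_of_properlyDiscontinuousSMul
    (fun {x y} => orbitRel_deckGroup_iff hq F x y)

theorem exists_homeomorph_quotient_deckGroup {M X : Type*} [TopologicalSpace M]
    [TopologicalSpace X] {q : ℝ × ℝ → M} (hq : IsTorusCover q) (F : ℝ × ℝ ≃ₜ X) :
    ∃ e : MulAction.orbitRel.Quotient (deckGroup F) X ≃ₜ M,
      ∀ x, e (Quotient.mk _ x) = q (F.symm x) := by
  have h := hq.isLocalHomeomorph.comp F.symm.isLocalHomeomorph
  let f : MulAction.orbitRel.Quotient (deckGroup F) X → M :=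
    Quotient.lift (q ∘ F.symm) fun x y hxy => (orbitRel_deckGroup_iff hq F x y).2 hxy
  have hf : Continuous f := h.continuous.quotient_lift _
  have hfo : IsOpenMap f := by
    intro U hU
    have : f '' U = (q ∘ F.symm) '' (Quotient.mk _ ⁻¹' U) := by
      ext m
      constructor
      · rintro ⟨⟨x⟩, hx, rfl⟩
        exact ⟨x, hx, rfl⟩
      · rintro ⟨x, hx, rfl⟩
        exact ⟨_, hx, rfl⟩
    rw [this]
    exact h.isOpenMap _ (hU.preimage continuous_quotient_mk')
  have hb : Function.Bijective f := by
    constructor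
    · rintro ⟨x⟩ ⟨y⟩ hxy
      exact Quotient.sound ((orbitRel_deckGroup_iff hq F x y).1 hxy)
    · intro m
      obtain ⟨x, rfl⟩ := hq.surjective m
      exact ⟨Quotient.mk _ (F x), by simp [f]⟩
  exact ⟨(Equiv.ofBijective f hb).toHomeomorphOfContinuousOpen hf hfo, fun x => rfl⟩

/-- The hypothesis `hF` only speaks of the preferred chart at each point; compatibility of the atlas
of `M` extends it to every chart. -/
theorem affGerm_chart_comp {M X : Type*} [TopologicalSpace M] [ChartedSpace AffPlane M]
    [HasGroupoid M affGroupoid] [TopologicalSpace X] {q : ℝ × ℝ → M} (hq : IsTorusCover q)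
    {δ : X → AffPlane} {F : ℝ × ℝ ≃ₜ X}
    (hF : ∀ x, AffGerm (fun y => δ (F y)) (fun y => chartAt AffPlane (q x) (q y)) x)
    {c : OpenPartialHomeomorph M AffPlane} (hc : c ∈ atlas AffPlane M) (x : X)
    (hx : q (F.symm x) ∈ c.source) : AffGerm (fun y => c (q (F.symm y))) δ x := by
  have h1 := (hF (F.symm x)).symm.comp (f := F.symm) F.symm.continuous.continuousAt
  simp only [Homeomorph.apply_symm_apply] at h1
  exact ((affGerm_of_mem_atlas hc (chart_mem_atlas AffPlane (q (F.symm x))) hx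
    (mem_chart_source _ _)).comp (f := fun y => q (F.symm y))
    (hq.isLocalHomeomorph.continuous.comp F.symm.continuous).continuousAt).trans h1

/-- The deck transformations are affine diffeomorphisms. -/
theorem exists_structomorph_of_mem_deckGroup {M X : Type*} [TopologicalSpace M]
    [ChartedSpace AffPlane M] [HasGroupoid M affGroupoid] [TopologicalSpace X]
    [ChartedSpace AffPlane X] {q : ℝ × ℝ → M} (hq : IsTorusCover q)
    {δ : X → AffPlane} (hδ : IsDevelopingMap X δ) {F : ℝ × ℝ ≃ₜ X}
    (hF : ∀ x, AffGerm (fun y => δ (F y)) (fun y => chartAt AffPlane (q x) (q y)) x)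
    {g : X ≃ₜ X} (hg : g ∈ deckGroup F) :
    ∃ φ : Structomorph affGroupoid X X, φ.toHomeomorph = g := by
  have hinv : ∀ x, q (F.symm (g x)) = q (F.symm x) := fun x =>
    (orbitRel_deckGroup_iff hq F _ _).2 ⟨⟨g, hg⟩, rfl⟩
  refine ⟨structomorphOfAffGerm g fun c hc c' hc' x hx hx' => ?_, rfl⟩
  have k1 : AffGerm (fun y => c' (g y)) (fun y => δ (g y)) x :=
    (hδ c' hc' _ hx').comp g.continuous.continuousAt
  -- The deck transformation preserves `q ∘ F.symm`. The same chart of `M` thus compares `δ` at `g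
  -- x` and at `x`, so that `δ ∘ g` and `δ` have the same affine germ.
  have k2 := (affGerm_chart_comp hq hF (chart_mem_atlas AffPlane (q (F.symm x))) (g x)
    (by rw [hinv]; exact mem_chart_source _ _)).symm.comp g.continuous.continuousAt
  simp only [hinv] at k2
  exact ((k1.trans k2).trans (affGerm_chart_comp hq hF (chart_mem_atlas AffPlane _) x
    (mem_chart_source _ _))).trans (hδ c hc x hx).symm

variable {M : Type u} [TopologicalSpace M] [ChartedSpace AffPlane M] [HasGroupoid M affGroupoid]
  {X : Type v} [TopologicalSpace X] [T2Space X] [LocallyCompactSpace X] [ChartedSpace AffPlane X]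

theorem isAffQuotientBy_deckGroup {q : ℝ × ℝ → M} (hq : IsTorusCover q) {δ : X → AffPlane}
    (hδ : IsDevelopingMap X δ) {F : ℝ × ℝ ≃ₜ X}
    (hF : ∀ x, AffGerm (fun y => δ (F y)) (fun y => chartAt AffPlane (q x) (q y)) x) :
    IsAffQuotientBy M X (deckGroup F) := by
  have hPD := properlyDiscontinuousSMul_deckGroup F
  have hCS := isCancelSMul_deckGroup F
  obtain ⟨e, he⟩ := exists_homeomorph_quotient_deckGroup hq F
  have hmk := (isQuotientCoveringMap_quotientMk_of_properlyDiscontinuousSMul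
    (G := deckGroup F) (E := X)).isCoveringMap.isLocalHomeomorph
  refine ⟨hPD, hCS, ⟨Structomorph.symm (structomorphOfAffGerm e ?_)⟩⟩
  rintro c ⟨x₀, rfl⟩ c' hc' y hy hy'
  -- The quotient chart indexed by `x₀` is the local inverse `σ` of the projection at a chosen
  -- representative `g` of `x₀`, followed by the chart of `X` at `g`.
  set g := Function.Surjective.hasRightInverse
    (Quotient.mk_surjective (s := MulAction.orbitRel (deckGroup F) X)) |>.choose x₀
  set σ := hmk.localInverseAt g with hσ
  have hy1 : y ∈ σ.source := by
    have := hy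
    rw [OpenPartialHomeomorph.trans_source] at this
    exact this.1
  have hy2 : σ y ∈ (chartAt AffPlane g).source := by
    have := hy
    rw [OpenPartialHomeomorph.trans_source] at this
    exact this.2
  have hsymm : ∀ z, σ.symm z = Quotient.mk _ z := fun z => by
    rw [hσ, hmk.localInverseAt_symm]
  have hmy : Quotient.mk _ (σ y) = y := by rw [← hsymm, σ.left_inv hy1]
  rw [← hmy] at hy' ⊢
  -- The projection is open, so the comparison may be made at the point `σ y` of `X`, where `σ`
  -- cancels the projection.
  refine AffGerm.of_comp hmk.isOpenMap ?_
  simp only [he] at hy' ⊢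
  have h1 := (affGerm_chart_comp hq hF hc' (σ y) hy').trans
    (hδ _ (chart_mem_atlas AffPlane g) _ hy2).symm
  refine h1.trans (AffGerm.of_eventuallyEq ?_)
  filter_upwards [σ.open_target.mem_nhds (σ.map_source hy1)] with z hz
  change _ = chartAt AffPlane g (σ (Quotient.mk _ z))
  rw [← hsymm, σ.right_inv hz]

/-- Two simply connected coverings of `M` lift through each other, and uniqueness of lifts makes the
two lifts mutually inverse. The resulting homeomorphism covers the identity of `M`, hence is affine
in charts. -/
theorem universalAffCoverIs_of_homeomorph {q : ℝ × ℝ → M} (hq : IsTorusCover q) {δ : X → AffPlane}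
    (hδ : IsDevelopingMap X δ) {F : ℝ × ℝ ≃ₜ X}
    (hF : ∀ x, AffGerm (fun y => δ (F y)) (fun y => chartAt AffPlane (q x) (q y)) x) :
    UniversalAffCoverIs.{u, v, w} M X := by
  have hcov := (isQuotientCoveringMap_comp_symm hq F).isCoveringMap
  have hsurj := hq.surjective.comp F.symm.surjective
  have hsc : SimplyConnectedSpace X := F.symm.toHomotopyEquiv.simplyConnectedSpace
  have hlp : LocallyPathConnectedSpace X := ChartedSpace.locallyPathConnectedSpace AffPlane X
  refine ⟨⟨q ∘ F.symm, hsc, hcov, hsurj, hcov.continuous, fun x => ?_⟩, ?_⟩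
  · exact (affGerm_chart_comp hq hF (chart_mem_atlas AffPlane _) x (mem_chart_source _ _)).trans
      (hδ _ (chart_mem_atlas AffPlane x) _ (mem_chart_source _ _)).symm
  · intro N _ _ _ q' hq'
    have hscN := hq'.simplyConnected
    have hlpN : LocallyPathConnectedSpace N := ChartedSpace.locallyPathConnectedSpace AffPlane N
    obtain ⟨n₀⟩ : Nonempty N := inferInstance
    obtain ⟨x₀, hx₀⟩ := hsurj (q' n₀)
    obtain ⟨G, ⟨hG0, hG⟩, -⟩ := hcov.existsUnique_continuousMap_lifts
      ⟨q', hq'.isCoveringMap.continuous⟩ n₀ x₀ hx₀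
    obtain ⟨G', ⟨hG'0, hG'⟩, -⟩ := hq'.isCoveringMap.existsUnique_continuousMap_lifts
      ⟨q ∘ F.symm, hcov.continuous⟩ x₀ n₀ hx₀.symm
    have hG1 : ∀ n, q (F.symm (G n)) = q' n := fun n => congrFun hG n
    have hG'1 : ∀ x, q' (G' x) = q (F.symm x) := fun x => congrFun hG' x
    have h1 : G' ∘ G = id := hq'.isCoveringMap.eq_of_comp_eq (G'.continuous.comp G.continuous)
      continuous_id (by ext n; simp [hG1, hG'1]) n₀ (by simp [hG0, hG'0])
    have h2 : G ∘ G' = id := hcov.eq_of_comp_eq (G.continuous.comp G'.continuous)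
      continuous_id (by ext n; simp [hG1, hG'1]) x₀ (by simp [hG0, hG'0])
    let e : N ≃ₜ X := ⟨⟨G, G', congrFun h1, congrFun h2⟩, G.continuous, G'.continuous⟩
    have he : ∀ n, q (F.symm (e n)) = q' n := hG1
    refine ⟨structomorphOfAffGerm e fun c hc c' hc' n hn hn' => ?_⟩
    have k1 : AffGerm (fun y => c' (e y)) (fun y => δ (e y)) n :=
      (hδ c' hc' _ hn').comp e.continuous.continuousAt
    have k2 := (affGerm_chart_comp hq hF (chart_mem_atlas AffPlane (q' n)) (e n)
      (by rw [he]; exact mem_chart_source _ _)).symm.comp e.continuous.continuousAt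
    simp only [he] at k2
    have k3 : AffGerm (fun y => chartAt AffPlane (q' n) (q' y)) (chartAt AffPlane n) n :=
      hq'.isAffMap.2 n
    exact ((k1.trans k2).trans k3).trans (affGerm_of_mem_atlas (chart_mem_atlas AffPlane n) hc
      (mem_chart_source _ _) hn)

end Assembly

/-! ### Existence and uniqueness of developing maps -/

/-- On the line from `z` to any `w`, agreement at `z` and at one other point near `z` already forces
agreement at `w`. -/
theorem AffineEquiv.eq_of_eventuallyEq {A B : AffPlane ≃ᵃ[ℝ] AffPlane} {z : AffPlane}
    (h : (A : AffPlane → AffPlane) =ᶠ[𝓝 z] B) : A = B := by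
  ext1 w
  have hc : Tendsto (fun t : ℝ => AffineMap.lineMap z w t) (𝓝[≠] 0) (𝓝 z) := by
    have : Continuous fun t : ℝ => AffineMap.lineMap z w t := AffineMap.lineMap_continuous
    have h0 := this.tendsto 0
    rw [AffineMap.lineMap_apply_zero] at h0
    exact h0.mono_left nhdsWithin_le_nhds
  obtain ⟨t, ht, ht0⟩ := ((hc.eventually h).and self_mem_nhdsWithin).exists
  have hz := h.self_of_nhds
  rw [← AffineEquiv.coe_toAffineMap A, ← AffineEquiv.coe_toAffineMap B, AffineMap.apply_lineMap,
    AffineMap.apply_lineMap] at ht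
  simp only [AffineEquiv.coe_toAffineMap] at ht
  rw [hz, AffineMap.lineMap_apply, AffineMap.lineMap_apply] at ht
  have h2 := smul_right_injective _ ht0 (vadd_right_cancel _ ht)
  exact vsub_left_cancel h2

/-- Openness of `ψ` at `x` turns agreement along `ψ` into agreement near `ψ x`. This rigidity makes
transitions and holonomy well defined. -/
theorem AffineEquiv.eq_of_comp_eventuallyEq {N : Type*} [TopologicalSpace N] {x : N}
    {ψ : N → AffPlane} (hψ : 𝓝 (ψ x) ≤ map ψ (𝓝 x)) {A B : AffPlane ≃ᵃ[ℝ] AffPlane}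
    (h : (fun y => A (ψ y)) =ᶠ[𝓝 x] fun y => B (ψ y)) : A = B :=
  AffineEquiv.eq_of_eventuallyEq (z := ψ x) (hψ (eventually_map.2 h))

section Developing

variable {B : Type*} [TopologicalSpace B]

/-- A family of plane-valued open maps on open sets which cover `B`, any two of which differ
locally by affine transformations. -/
structure AffAtlas (B : Type*) [TopologicalSpace B] (ι : Type*) where
  /-- The domains. -/
  dom : ι → Set B
  isOpen_dom : ∀ i, IsOpen (dom i)
  /-- The index of a map defined at a point. -/
  idx : B → ι
  mem_dom : ∀ x, x ∈ dom (idx x)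
  /-- The maps. -/
  map : ι → B → AffPlane
  nhds_le : ∀ i, ∀ x ∈ dom i, 𝓝 (map i x) ≤ Filter.map (map i) (𝓝 x)
  affGerm : ∀ i j, ∀ x ∈ dom i ∩ dom j, AffGerm (map i) (map j) x

namespace AffAtlas

variable {ι : Type*} (𝒜 : AffAtlas B ι)

open Classical in
/-- The affine transformation taking the `j`-th map to the `i`-th map near `x`. -/
noncomputable def transition (i j : ι) (x : B) : AffPlane ≃ᵃ[ℝ] AffPlane :=
  if h : AffGerm (𝒜.map i) (𝒜.map j) x then h.choose else AffineEquiv.refl ℝ AffPlane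

theorem transition_spec {i j : ι} {x : B} (hx : x ∈ 𝒜.dom i ∩ 𝒜.dom j) :
    𝒜.map i =ᶠ[𝓝 x] fun y => 𝒜.transition i j x (𝒜.map j y) := by
  have h := 𝒜.affGerm i j x hx
  rw [transition, dif_pos h]
  exact h.choose_spec

theorem transition_eq {i j : ι} {x : B} (hx : x ∈ 𝒜.dom i ∩ 𝒜.dom j)
    {A : AffPlane ≃ᵃ[ℝ] AffPlane} (hA : 𝒜.map i =ᶠ[𝓝 x] fun y => A (𝒜.map j y)) :
    𝒜.transition i j x = A :=
  AffineEquiv.eq_of_comp_eventuallyEq (𝒜.nhds_le j x hx.2) ((𝒜.transition_spec hx).symm.trans hA)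

/-- Local constancy of the transitions is what allows the fibre of germs to carry the discrete
topology, which makes the bundle a covering. -/
theorem eventually_transition_eq {i j : ι} {x : B} (hx : x ∈ 𝒜.dom i ∩ 𝒜.dom j) :
    ∀ᶠ y in 𝓝 x, 𝒜.transition i j y = 𝒜.transition i j x := by
  filter_upwards [(𝒜.transition_spec hx).eventually_nhds,
    ((𝒜.isOpen_dom i).inter (𝒜.isOpen_dom j)).mem_nhds hx] with y hy hyd
  exact 𝒜.transition_eq hyd hy

/-- The affine group with the discrete topology. -/
def DiscreteAff : Type := AffPlane ≃ᵃ[ℝ] AffPlane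

instance : TopologicalSpace DiscreteAff := ⊥
instance : DiscreteTopology DiscreteAff := ⟨rfl⟩

/-- The underlying affine transformation. -/
def DiscreteAff.toAff (A : DiscreteAff) : AffPlane ≃ᵃ[ℝ] AffPlane := A

/-- An affine transformation as a point of the discrete space. -/
def DiscreteAff.of (A : AffPlane ≃ᵃ[ℝ] AffPlane) : DiscreteAff := A

/-- The bundle of germs of developing maps. -/
noncomputable def germBundle : FiberBundleCore ι B DiscreteAff where
  baseSet := 𝒜.dom
  isOpen_baseSet := 𝒜.isOpen_dom
  indexAt := 𝒜.idx
  mem_baseSet_at := 𝒜.mem_dom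
  coordChange i j x A := .of ((𝒜.transition i j x).trans A.toAff)
  coordChange_self := by
    intro i x hx A
    have : 𝒜.transition i i x = AffineEquiv.refl ℝ AffPlane :=
      𝒜.transition_eq ⟨hx, hx⟩ (by filter_upwards with y; simp)
    rw [this]
    exact AffineEquiv.refl_trans _
  continuousOn_coordChange := by
    rintro i j ⟨x, A⟩ ⟨hx, -⟩
    refine ContinuousAt.continuousWithinAt ?_
    refine (continuousAt_const (y := DiscreteAff.of ((𝒜.transition i j x).trans
      A.toAff))).congr ?_
    have h1 : ∀ᶠ p in 𝓝 (x, A), 𝒜.transition i j p.1 = 𝒜.transition i j x :=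
      continuous_fst.continuousAt.eventually (𝒜.eventually_transition_eq hx)
    have h2 : ∀ᶠ p in 𝓝 (x, A), p.2 = A :=
      continuous_snd.continuousAt.eventually (p := fun C => C = A) (mem_nhds_discrete.2 rfl)
    filter_upwards [h1, h2] with p hp1 hp2
    rw [hp1, hp2]
  coordChange_comp := by
    rintro i j k x ⟨⟨hi, hj⟩, hk⟩ A
    have : 𝒜.transition i k x = (𝒜.transition j k x).trans (𝒜.transition i j x) := by
      refine 𝒜.transition_eq ⟨hi, hk⟩ ?_
      filter_upwards [𝒜.transition_spec ⟨hi, hj⟩, 𝒜.transition_spec ⟨hj, hk⟩] with y h1 h2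
      rw [h1, h2]
      rfl
    rw [this]
    rfl

/-- The germ bundle is a covering of a simply connected base, so it has a global section. Evaluating
at each point the germ selected by the section gives `D`; in a local trivialization the section is
locally constant, so `D` is a fixed affine map composed with a chart. -/
theorem exists_developing [SimplyConnectedSpace B] [LocallyPathConnectedSpace B] :
    ∃ D : B → AffPlane, ∀ x, AffGerm D (𝒜.map (𝒜.idx x)) x := by
  obtain ⟨x₀⟩ : Nonempty B := inferInstance
  have hcov : IsCoveringMap (Bundle.TotalSpace.proj : 𝒜.germBundle.TotalSpace → B) :=
    FiberBundle.isCoveringMap (F := DiscreteAff) (E := 𝒜.germBundle.Fiber)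
  -- A lift of the identity is a section; the initial germ is the chart at `x₀` itself, the identity
  -- being an arbitrary choice.
  obtain ⟨σ, ⟨-, hσ⟩, -⟩ := hcov.existsUnique_continuousMap_lifts (ContinuousMap.id B) x₀
    (⟨x₀, DiscreteAff.of (AffineEquiv.refl ℝ AffPlane)⟩ : 𝒜.germBundle.TotalSpace) rfl
  have hσ' : ∀ y, (σ y).1 = y := fun y => congrFun hσ y
  refine ⟨fun y => DiscreteAff.toAff (σ y).2 (𝒜.map (𝒜.idx (σ y).1) (σ y).1),
    fun x => ?_⟩
  set e := 𝒜.germBundle.localTriv (𝒜.idx x)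
  have hx : σ x ∈ e.source := by
    rw [e.mem_source]
    change (σ x).1 ∈ 𝒜.dom (𝒜.idx x)
    rw [hσ']
    exact 𝒜.mem_dom x
  have hc : ContinuousAt (fun y => (e (σ y)).2) x :=
    continuous_snd.continuousAt.comp ((e.continuousAt hx).comp σ.continuous.continuousAt)
  have hev : ∀ᶠ y in 𝓝 x, (e (σ y)).2 = (e (σ x)).2 :=
    hc.eventually (p := fun A => A = (e (σ x)).2) (mem_nhds_discrete.2 rfl)
  refine ⟨(e (σ x)).2.toAff, ?_⟩
  filter_upwards [hev, σ.continuous.continuousAt.eventually (e.open_source.mem_nhds hx)]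
    with y hy hy'
  have hy1 : (σ y).1 ∈ 𝒜.dom (𝒜.idx x) := e.mem_source.1 hy'
  have hs := (𝒜.transition_spec (i := 𝒜.idx (σ y).1) (j := 𝒜.idx x) (x := (σ y).1)
    ⟨𝒜.mem_dom _, hy1⟩).self_of_nhds
  have hlast : (e (σ y)).2.toAff (𝒜.map (𝒜.idx x) (σ y).1) =
      (e (σ x)).2.toAff (𝒜.map (𝒜.idx x) y) := by rw [hy, hσ' y]
  rw [hs]
  exact hlast

end AffAtlas

/-- Two developing maps on a connected space differ by an affine transformation. -/
theorem exists_affineEquiv_of_affGerm [PreconnectedSpace B] [Nonempty B] {D D' : B → AffPlane}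
    (hD : IsOpenMap D) (h : ∀ x, AffGerm D' D x) :
    ∃ A : AffPlane ≃ᵃ[ℝ] AffPlane, ∀ x, D' x = A (D x) := by
  obtain ⟨x₀⟩ := ‹Nonempty B›
  obtain ⟨A, hA⟩ := h x₀
  -- The set where the germ of `D'` is `A ∘ D` is open by definition, and closed because the affine
  -- map realizing a germ is unique.
  let U : Set B := {x | D' =ᶠ[𝓝 x] fun y => A (D y)}
  have hU : IsOpen U := isOpen_iff_mem_nhds.2 fun x hx => by
    filter_upwards [hx.eventually_nhds] with y hy using hy
  have hU' : IsOpen Uᶜ := isOpen_iff_mem_nhds.2 fun x hx => by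
    obtain ⟨C, hC⟩ := h x
    filter_upwards [hC.eventually_nhds] with y hy hy'
    have hCA : C = A := AffineEquiv.eq_of_comp_eventuallyEq (hD.nhds_le y)
      ((EventuallyEq.symm hy).trans hy')
    subst hCA
    exact hx hC
  have hUu : U = univ := IsClopen.eq_univ ⟨⟨hU'⟩, hU⟩ ⟨x₀, hA⟩
  refine ⟨A, fun x => ?_⟩
  have hx : x ∈ U := hUu ▸ mem_univ x
  exact hx.self_of_nhds

end Developing

theorem exists_developing_of_isLocalHomeomorph {M : Type*} [TopologicalSpace M]
    [ChartedSpace AffPlane M] [HasGroupoid M affGroupoid] {B : Type*} [TopologicalSpace B]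
    [SimplyConnectedSpace B] [LocallyPathConnectedSpace B] {q : B → M}
    (hq : IsLocalHomeomorph q) : ∃ D : B → AffPlane,
      ∀ x, AffGerm D (fun y => chartAt AffPlane (q x) (q y)) x := by
  let 𝒜 : AffAtlas B B :=
    { dom := fun i => q ⁻¹' (chartAt AffPlane (q i)).source
      isOpen_dom := fun i => (chartAt AffPlane (q i)).open_source.preimage hq.continuous
      idx := id
      mem_dom := fun x => mem_chart_source AffPlane (q x)
      map := fun i y => chartAt AffPlane (q i) (q y)
      nhds_le := fun i x hx => by
        have h1 := hq.map_nhds_eq x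
        have h2 := (chartAt AffPlane (q i)).map_nhds_eq hx
        rw [← h1, Filter.map_map] at h2
        exact h2.ge
      affGerm := fun i j x hx => (affGerm_of_mem_atlas (chart_mem_atlas AffPlane (q i))
        (chart_mem_atlas AffPlane (q j)) hx.1 hx.2).comp hq.continuous.continuousAt }
  exact 𝒜.exists_developing

theorem isLocalHomeomorph_of_affGerm {M : Type*} [TopologicalSpace M] [ChartedSpace AffPlane M]
    {B : Type*} [TopologicalSpace B] {q : B → M}
    (hq : IsLocalHomeomorph q) {D : B → AffPlane}
    (hD : ∀ x, AffGerm D (fun y => chartAt AffPlane (q x) (q y)) x) : IsLocalHomeomorph D := by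
  refine IsLocalHomeomorph.mk _ fun x => ?_
  obtain ⟨A, hA⟩ := hD x
  obtain ⟨e, he, rfl⟩ := hq x
  obtain ⟨U, hU, hUo, hxU⟩ := eventually_nhds_iff.1 hA
  let A' : AffPlane ≃ₜ AffPlane :=
    ⟨A.toEquiv, A.continuous_affPlane, A.symm.continuous_affPlane⟩
  refine ⟨((e.trans (chartAt AffPlane (e x))).trans A'.toOpenPartialHomeomorph).restr U, ?_, ?_⟩
  · simp [he, hUo.interior_eq, hxU]
  · intro y hy
    rw [OpenPartialHomeomorph.restr_source, hUo.interior_eq] at hy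
    exact hU y hy.2

/-- A developing map of the torus is equivariant for a holonomy homomorphism. -/
theorem exists_holonomy {M : Type*} [TopologicalSpace M] [ChartedSpace AffPlane M]
    {q : ℝ × ℝ → M} (hq : IsTorusCover q) {D : ℝ × ℝ → AffPlane}
    (hD : ∀ x, AffGerm D (fun y => chartAt AffPlane (q x) (q y)) x) (γ : ℤ × ℤ) :
    ∃ A : AffPlane ≃ᵃ[ℝ] AffPlane, ∀ x, D (latticeShift γ x) = A (D x) := by
  refine exists_affineEquiv_of_affGerm
    (isLocalHomeomorph_of_affGerm hq.isLocalHomeomorph hD).isOpenMap fun x => ?_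
  have h1 := (hD (latticeShift γ x)).comp (latticeShift γ).continuous.continuousAt
  have h2 : ∀ y, q (latticeShift γ y) = q y := fun y => ((hq.eq_iff _ _).2 ⟨γ, rfl⟩).symm
  simp only [h2] at h1
  exact h1.trans (hD x).symm

/-! ### Lifting flows through equivariant local homeomorphisms -/

section FlowLift

/-- A flow on `E`: a jointly continuous additive action of `ℝ`. -/
structure IsFlow {E : Type*} [TopologicalSpace E] (φ : ℝ → E → E) : Prop where
  continuous : Continuous fun p : ℝ × E => φ p.1 p.2
  zero : ∀ z, φ 0 z = z
  add : ∀ s t z, φ (s + t) z = φ s (φ t z)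

/-- The `D`-lift of the `φ`-trajectory through `x` exists for times in `[-ε, ε]`. -/
def HasFlowLift {P E : Type*} [TopologicalSpace P] (D : P → E) (φ : ℝ → E → E) (ε : ℝ) (x : P) : Prop :=
  ∃ c : ℝ → P, ContinuousOn c (Icc (-ε) ε) ∧ c 0 = x ∧ ∀ t ∈ Icc (-ε) ε, D (c t) = φ t (D x)

theorem HasFlowLift.mono {P E : Type*} [TopologicalSpace P] {D : P → E} {φ : ℝ → E → E} {ε ε' : ℝ} {x : P}
    (h : HasFlowLift D φ ε x) (hε : ε' ≤ ε) : HasFlowLift D φ ε' x := by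
  obtain ⟨c, hc, hc0, hcD⟩ := h
  have hsub : Icc (-ε') ε' ⊆ Icc (-ε) ε := Icc_subset_Icc (by linarith) hε
  exact ⟨c, hc.mono hsub, hc0, fun t ht => hcD t (hsub ht)⟩

variable {P E Γ : Type*} [TopologicalSpace P] [TopologicalSpace E]

/-- For short times the trajectories starting near `D x` stay in the target of one local inverse of
`D`, which lifts them. -/
theorem IsLocalHomeomorph.exists_hasFlowLift_nhds {D : P → E} (hD : IsLocalHomeomorph D)
    {φ : ℝ → E → E} (hφ : IsFlow φ) (x : P) :
    ∃ U ∈ 𝓝 x, ∃ ε > 0, ∀ y ∈ U, HasFlowLift D φ ε y := by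
  obtain ⟨e, hx, rfl⟩ := hD x
  have hcont : Continuous fun p : ℝ × P => φ p.1 (e p.2) :=
    hφ.continuous.comp (continuous_fst.prodMk (hD.continuous.comp continuous_snd))
  have h1 : ∀ᶠ p in 𝓝 ((0 : ℝ), x), φ p.1 (e p.2) ∈ e.target := by
    refine hcont.continuousAt.eventually (e.open_target.mem_nhds ?_)
    simpa [hφ.zero] using e.map_source hx
  rw [nhds_prod_eq] at h1
  obtain ⟨pa, hpa, pb, hpb, hab⟩ := eventually_prod_iff.1 h1
  obtain ⟨ε, hε, hεs⟩ := Metric.nhds_basis_closedBall.mem_iff.1 hpa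
  rw [Real.closedBall_eq_Icc, zero_sub, zero_add] at hεs
  refine ⟨{y | pb y} ∩ e.source, inter_mem hpb (e.open_source.mem_nhds hx), ε, hε, ?_⟩
  rintro y ⟨hy, hys⟩
  refine ⟨fun t => e.symm (φ t (e y)), ?_, ?_, ?_⟩
  · refine e.continuousOn_symm.comp ?_ fun t ht => hab (hεs ht) hy
    exact (hcont.comp (continuous_id.prodMk continuous_const)).continuousOn
  · simp [hφ.zero, hys]
  · intro t ht
    exact e.right_inv (hab (hεs ht) hy)

/-- Compactness gives a uniform `ε` over `K`. Since `φ` commutes with `H`, lifts starting in `K` are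
carried by the group to lifts starting anywhere. -/
theorem IsLocalHomeomorph.exists_hasFlowLift {D : P → E} (hD : IsLocalHomeomorph D)
    {φ : ℝ → E → E} (hφ : IsFlow φ) {τ : Γ → P ≃ₜ P} {K : Set P} (hK : IsCompact K)
    (hτK : ∀ x, ∃ γ, τ γ x ∈ K) {H : Γ → E ≃ E} (hτ : ∀ γ x, D (τ γ x) = H γ (D x))
    (hH : ∀ γ t z, φ t (H γ z) = H γ (φ t z)) :
    ∃ ε > 0, ∀ x, HasFlowLift D φ ε x := by
  have hKlift : ∃ ε > 0, ∀ x ∈ K, HasFlowLift D φ ε x := by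
    refine hK.induction_on (p := fun S => ∃ ε > 0, ∀ x ∈ S, HasFlowLift D φ ε x) ?_ ?_ ?_ ?_
    · exact ⟨1, one_pos, by simp⟩
    · rintro s t hst ⟨ε, hε, h⟩
      exact ⟨ε, hε, fun x hx => h x (hst hx)⟩
    · rintro s t ⟨ε, hε, h⟩ ⟨ε', hε', h'⟩
      refine ⟨min ε ε', lt_min hε hε', ?_⟩
      rintro x (hx | hx)
      · exact (h x hx).mono (min_le_left _ _)
      · exact (h' x hx).mono (min_le_right _ _)
    · intro x _
      obtain ⟨U, hU, h⟩ := hD.exists_hasFlowLift_nhds hφ x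
      exact ⟨U, mem_nhdsWithin_of_mem_nhds hU, h⟩
  obtain ⟨ε, hε, h⟩ := hKlift
  refine ⟨ε, hε, fun x => ?_⟩
  obtain ⟨γ, hγ⟩ := hτK x
  obtain ⟨c, hc, hc0, hcD⟩ := h _ hγ
  refine ⟨fun t => (τ γ).symm (c t), (τ γ).symm.continuous.comp_continuousOn hc, by simp [hc0],
    fun t ht => (H γ).injective ?_⟩
  rw [← hτ, ← hH, ← hτ, Homeomorph.apply_symm_apply, hcD t ht]

variable [T2Space P]

theorem flowLift_unique {D : P → E} (hD : IsLocalHomeomorph D) {s : Set ℝ} (hs : IsPreconnected s)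
    {c c' : ℝ → P} (hc : ContinuousOn c s) (hc' : ContinuousOn c' s)
    (h : ∀ t ∈ s, D (c t) = D (c' t)) {a : ℝ} (ha : a ∈ s) (hac : c a = c' a) : EqOn c c' s :=
  (T2Space.isSeparatedMap D).eqOn_of_comp_eqOn hD.isLocallyInjective hs hc hc' h ha hac

/-- New lifts of duration `ε` are launched from the endpoints `c (-ε)` and `c ε`. By uniqueness each
of them passes back through `x`, so the two glue at time `0`. -/
theorem hasFlowLift_two_mul {D : P → E} (hD : IsLocalHomeomorph D) {φ : ℝ → E → E}
    (hφ : IsFlow φ) {ε : ℝ} (hε : 0 < ε) (h : ∀ x, HasFlowLift D φ ε x) (x : P) :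
    HasFlowLift D φ (2 * ε) x := by
  obtain ⟨c, hc, hc0, hcD⟩ := h x
  obtain ⟨a, ha, ha0, haD⟩ := h (c (-ε))
  obtain ⟨b, hb, hb0, hbD⟩ := h (c ε)
  have haD' : ∀ t ∈ Icc (-(2 * ε)) 0, D (a (t + ε)) = φ t (D x) := by
    intro t ht
    rw [haD _ ⟨by linarith [ht.1], by linarith [ht.2]⟩, hcD _ ⟨le_rfl, by linarith⟩, ← hφ.add]
    simp
  have hbD' : ∀ t ∈ Icc 0 (2 * ε), D (b (t - ε)) = φ t (D x) := by
    intro t ht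
    rw [hbD _ ⟨by linarith [ht.1], by linarith [ht.2]⟩, hcD _ ⟨by linarith, le_rfl⟩, ← hφ.add]
    simp
  have ha' : ContinuousOn (fun t => a (t + ε)) (Icc (-(2 * ε)) 0) :=
    ha.comp (by fun_prop) fun t ht => ⟨by linarith [ht.1], by linarith [ht.2]⟩
  have hb' : ContinuousOn (fun t => b (t - ε)) (Icc 0 (2 * ε)) :=
    hb.comp (by fun_prop) fun t ht => ⟨by linarith [ht.1], by linarith [ht.2]⟩
  have h1 : a (0 + ε) = x := by
    rw [← hc0]
    refine flowLift_unique hD (isPreconnected_Icc (a := -ε) (b := 0))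
      (ha'.mono (Icc_subset_Icc (by linarith) le_rfl)) (hc.mono (Icc_subset_Icc le_rfl hε.le))
      (fun t ht => ?_) ⟨le_rfl, by linarith⟩ (by simp [ha0]) ⟨by linarith, le_rfl⟩
    rw [haD' t ⟨by linarith [ht.1], ht.2⟩, hcD t ⟨ht.1, by linarith [ht.2]⟩]
  have h2 : b (0 - ε) = x := by
    rw [← hc0]
    refine flowLift_unique hD (isPreconnected_Icc (a := 0) (b := ε))
      (hb'.mono (Icc_subset_Icc le_rfl (by linarith)))
      (hc.mono (Icc_subset_Icc (by linarith) le_rfl))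
      (fun t ht => ?_) ⟨by linarith, le_rfl⟩ (by simp [hb0]) ⟨le_rfl, by linarith⟩
    rw [hbD' t ⟨ht.1, by linarith [ht.2]⟩, hcD t ⟨by linarith [ht.1], ht.2⟩]
  refine ⟨fun t => if t ≤ 0 then a (t + ε) else b (t - ε), ?_, by simpa using h1, ?_⟩
  · rw [← Icc_union_Icc_eq_Icc (b := (0 : ℝ)) (by linarith) (by linarith)]
    refine ContinuousOn.union_of_isClosed (ha'.congr fun t ht => if_pos ht.2)
      (hb'.congr fun t ht => ?_) isClosed_Icc isClosed_Icc
    by_cases h0 : t ≤ 0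
    · have : t = 0 := le_antisymm h0 ht.1
      subst this
      simp only [le_refl, if_true, h1, h2]
    · simp only [h0, if_false]
  · intro t ht
    by_cases h0 : t ≤ 0
    · simp only [h0, if_true]
      exact haD' t ⟨ht.1, h0⟩
    · simp only [h0, if_false]
      exact hbD' t ⟨(not_le.1 h0).le, ht.2⟩

theorem hasFlowLift_of_uniform {D : P → E} (hD : IsLocalHomeomorph D) {φ : ℝ → E → E}
    (hφ : IsFlow φ) {ε : ℝ} (hε : 0 < ε) (h : ∀ x, HasFlowLift D φ ε x) (R : ℝ) (x : P) :
    HasFlowLift D φ R x := by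
  have key : ∀ n : ℕ, ∀ x, HasFlowLift D φ (2 ^ n * ε) x := by
    intro n
    induction n with
    | zero => simpa using h
    | succ n ih =>
      intro x
      have := hasFlowLift_two_mul hD hφ (by positivity) ih x
      rwa [← mul_assoc, ← pow_succ'] at this
  obtain ⟨n, hn⟩ := pow_unbounded_of_one_lt (R / ε) one_lt_two
  exact (key n x).mono ((div_lt_iff₀ hε).1 hn).le

/-- A flow commuting with a cocompact group lifts through an equivariant local homeomorphism. -/
theorem exists_lift_flow {D : P → E} (hD : IsLocalHomeomorph D)
    {φ : ℝ → E → E} (hφ : IsFlow φ) {τ : Γ → P ≃ₜ P} {K : Set P} (hK : IsCompact K)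
    (hτK : ∀ x, ∃ γ, τ γ x ∈ K) {H : Γ → E ≃ E} (hτ : ∀ γ x, D (τ γ x) = H γ (D x))
    (hH : ∀ γ t z, φ t (H γ z) = H γ (φ t z)) :
    ∃ Φ : ℝ → P → P, (Continuous fun p : ℝ × P => Φ p.1 p.2) ∧ (∀ x, Φ 0 x = x) ∧
      ∀ t x, D (Φ t x) = φ t (D x) := by
  obtain ⟨ε, hε, hlift⟩ := hD.exists_hasFlowLift hφ hK hτK hτ hH
  have hall := hasFlowLift_of_uniform hD hφ hε hlift
  choose c hc hc0 hcD using hall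
  have hagree : ∀ R S x, R ≤ S → ∀ t ∈ Icc (-R) R, c R x t = c S x t := by
    intro R S x hRS t ht
    have hR : 0 ≤ R := by linarith [ht.1, ht.2]
    have hsub : Icc (-R) R ⊆ Icc (-S) S := Icc_subset_Icc (by linarith) hRS
    exact flowLift_unique hD isPreconnected_Icc (hc R x) ((hc S x).mono hsub)
      (fun s hs => by rw [hcD R x s hs, hcD S x s (hsub hs)])
      ⟨by linarith, hR⟩ (by rw [hc0, hc0]) ht
  let Φ : ℝ → P → P := fun t x => c |t| x t
  have hΦ : ∀ R x, ∀ t ∈ Icc (-R) R, Φ t x = c R x t := fun R x t ht =>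
    hagree _ _ x (abs_le.2 ht) t ⟨neg_abs_le t, le_abs_self t⟩
  have hΦ0 : ∀ x, Φ 0 x = x := fun x => hc0 _ x
  have hΦD : ∀ t x, D (Φ t x) = φ t (D x) := fun t x =>
    hcD _ x t ⟨neg_abs_le t, le_abs_self t⟩
  have hΦc : ∀ x, Continuous fun t => Φ t x := by
    intro x
    rw [continuous_iff_continuousAt]
    intro t
    have hmem : Icc (-(|t| + 1)) (|t| + 1) ∈ 𝓝 t :=
      Icc_mem_nhds (by linarith [neg_abs_le t]) (by linarith [le_abs_self t])
    refine ((hc (|t| + 1) x).continuousAt hmem).congr ?_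
    filter_upwards [hmem] with s hs
    exact (hΦ _ x s hs).symm
  refine ⟨Φ, ?_, hΦ0, hΦD⟩
  -- Joint continuity comes from homotopy lifting: the rescaled flow `Φ (s * t) x` lifts a homotopy
  -- in `s ∈ [0, 1]` that starts at the projection to `x`. The flow is its value at `s = 1`.
  have hf : Continuous fun p : unitInterval × (ℝ × P) => φ ((p.1 : ℝ) * p.2.1) (D p.2.2) := by
    have := hD.continuous
    exact hφ.continuous.comp (Continuous.prodMk (by fun_prop) (by fun_prop))
  have hg := hD.continuous_lift (T2Space.isSeparatedMap D) ⟨_, hf⟩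
    (g := fun p : unitInterval × (ℝ × P) => Φ ((p.1 : ℝ) * p.2.1) p.2.2)
    (by ext p; exact hΦD _ _) (by simpa only [Set.Icc.coe_zero, zero_mul, hΦ0] using continuous_snd)
    (fun a => (hΦc a.2).comp (by fun_prop))
  have := hg.comp (Continuous.prodMk (continuous_const (y := (1 : unitInterval))) continuous_id)
  simpa [Function.comp_def] using this

end FlowLift

/-! ### Local homeomorphisms to the plane with complete horizontal lines -/

section Strip

variable {P : Type*} [TopologicalSpace P]

/-- `σ` is a section of `F` over the strip `ℝ × J`. -/
structure IsStripSection (F : P → ℝ × ℝ) (J : Set ℝ) (σ : ℝ × ℝ → P) : Prop where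
  isOpen : IsOpen J
  ordConnected : J.OrdConnected
  continuousOn : ContinuousOn σ (univ ×ˢ J)
  right_inv : ∀ z ∈ univ ×ˢ J, F (σ z) = z

/-- The lifted horizontal flow provides strip sections through all points. -/
theorem exists_isStripSection {F : P → ℝ × ℝ} (hF : IsLocalHomeomorph F) {Φ : ℝ → P → P}
    (hΦ : Continuous fun p : ℝ × P => Φ p.1 p.2) (hΦ0 : ∀ x, Φ 0 x = x)
    (hΦF : ∀ t x, F (Φ t x) = ((F x).1 + t, (F x).2)) (x : P) :
    ∃ J σ, IsStripSection F J σ ∧ (F x).2 ∈ J ∧ σ (F x) = x := by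
  obtain ⟨e, hx, rfl⟩ := hF x
  have h1 : ∀ᶠ θ in 𝓝 (e x).2, ((e x).1, θ) ∈ e.target :=
    (Continuous.prodMk_right (e x).1).continuousAt.eventually
      (e.open_target.mem_nhds (e.map_source hx))
  obtain ⟨ε, hε, hball⟩ := Metric.nhds_basis_ball.mem_iff.1 h1
  rw [Real.ball_eq_Ioo] at hball
  refine ⟨Ioo ((e x).2 - ε) ((e x).2 + ε),
    fun z => Φ (z.1 - (e x).1) (e.symm ((e x).1, z.2)), ⟨isOpen_Ioo, ordConnected_Ioo, ?_, ?_⟩,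
    ⟨by linarith, by linarith⟩, ?_⟩
  · refine hΦ.comp_continuousOn (ContinuousOn.prodMk (by fun_prop) ?_)
    exact e.continuousOn_symm.comp (by fun_prop) fun z hz => hball hz.2
  · intro z hz
    rw [hΦF, e.right_inv (hball hz.2)]
    ext <;> simp
  · simp [hΦ0, hx]

variable [T2Space P]

/-- The common domain `ℝ × (J ∩ J')` is connected, so two sections that agree at one point agree
throughout. -/
theorem IsStripSection.eqOn {F : P → ℝ × ℝ} (hF : IsLocalHomeomorph F) {J J' : Set ℝ}
    {σ σ' : ℝ × ℝ → P} (h : IsStripSection F J σ) (h' : IsStripSection F J' σ') {z : ℝ × ℝ}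
    (hz : z.2 ∈ J ∩ J') (hzσ : σ z = σ' z) : EqOn σ σ' (univ ×ˢ (J ∩ J')) := by
  have hconn : IsPreconnected (univ ×ˢ (J ∩ J') : Set (ℝ × ℝ)) :=
    isPreconnected_univ.prod (h.ordConnected.inter h'.ordConnected).isPreconnected
  refine (T2Space.isSeparatedMap F).eqOn_of_comp_eqOn hF.isLocallyInjective hconn
    (h.continuousOn.mono (prod_mono_right inter_subset_left))
    (h'.continuousOn.mono (prod_mono_right inter_subset_right)) (fun w hw => ?_)
    (a := z) ⟨mem_univ _, hz⟩ hzσ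
  simp only [Function.comp_apply]
  rw [h.right_inv w ⟨mem_univ _, hw.2.1⟩, h'.right_inv w ⟨mem_univ _, hw.2.2⟩]

/-- A local homeomorphism from a connected surface to the plane through which all horizontal
lines lift is an embedding onto a horizontal strip. -/
theorem injective_and_range_of_horizontal_flow [ConnectedSpace P] {F : P → ℝ × ℝ}
    (hF : IsLocalHomeomorph F) {Φ : ℝ → P → P}
    (hΦ : Continuous fun p : ℝ × P => Φ p.1 p.2) (hΦ0 : ∀ x, Φ 0 x = x)
    (hΦF : ∀ t x, F (Φ t x) = ((F x).1 + t, (F x).2)) :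
    Function.Injective F ∧ ∃ J : Set ℝ, IsOpen J ∧ J.OrdConnected ∧ J.Nonempty ∧
      range F = univ ×ˢ J := by
  obtain ⟨p⟩ : Nonempty P := inferInstance
  let S : Set (Set ℝ × (ℝ × ℝ → P)) :=
    {s | IsStripSection F s.1 s.2 ∧ (F p).2 ∈ s.1 ∧ s.2 (F p) = p}
  -- Points reached by a strip section through the base point `p`. Showing that `W` is clopen makes
  -- every point reachable from `p` by one section.
  let W : Set P := {x | ∃ s ∈ S, (F x).2 ∈ s.1 ∧ s.2 (F x) = x}
  have hsec := exists_isStripSection hF hΦ hΦ0 hΦF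
  have hWp : p ∈ W := by
    obtain ⟨J, σ, h, hp, hσ⟩ := hsec p
    exact ⟨(J, σ), ⟨h, hp, hσ⟩, hp, hσ⟩
  have hsection_open : ∀ J σ, IsStripSection F J σ → ∀ x, (F x).2 ∈ J → σ (F x) = x →
      ∀ᶠ y in 𝓝 x, (F y).2 ∈ J ∧ σ (F y) = y := by
    intro J σ h x hx hσx
    obtain ⟨U, hU, hinj⟩ := (isLocallyInjective_iff_nhds.1 hF.isLocallyInjective) x
    have h1 : ∀ᶠ y in 𝓝 x, (F y).2 ∈ J :=
      (continuous_snd.comp hF.continuous).continuousAt.eventually (h.isOpen.mem_nhds hx)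
    have hcσ : ContinuousAt (fun y => σ (F y)) x := by
      have : ContinuousAt σ (F x) :=
        h.continuousOn.continuousAt ((isOpen_univ.prod h.isOpen).mem_nhds ⟨mem_univ _, hx⟩)
      exact this.comp hF.continuous.continuousAt
    have hU' : U ∈ 𝓝 (σ (F x)) := by rwa [hσx]
    have h2 : ∀ᶠ y in 𝓝 x, σ (F y) ∈ U := hcσ.eventually hU'
    filter_upwards [h1, h2, hU] with y hy1 hy2 hy3
    exact ⟨hy1, hinj hy2 hy3 (h.right_inv _ ⟨mem_univ _, hy1⟩)⟩
  have hWo : IsOpen W := isOpen_iff_mem_nhds.2 fun x ⟨s, hs, hx, hsx⟩ => by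
    filter_upwards [hsection_open s.1 s.2 hs.1 x hx hsx] with y hy
    exact ⟨s, hs, hy⟩
  have hWc : IsClosed W := by
    rw [← isOpen_compl_iff, isOpen_iff_mem_nhds]
    intro x hx
    obtain ⟨J', σ', h', hx', hσ'⟩ := hsec x
    filter_upwards [hsection_open J' σ' h' x hx' hσ'] with y hy
    rintro ⟨⟨J, σ⟩, ⟨hs, hp, hpσ⟩, hyJ, hyσ⟩
    apply hx
    simp only at hs hp hpσ hyJ hyσ
    have heq := hs.eqOn hF h' (z := F y) ⟨hyJ, hy.1⟩ (hyσ.trans hy.2.symm)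
    classical
    -- A section reaching a point `y` close to `x` agrees with the local section at `x` over the
    -- common strip, so the two glue. The intervals share the height of `y`, hence their union is an
    -- interval.
    refine ⟨(J ∪ J', fun z => if z.2 ∈ J then σ z else σ' z), ⟨⟨?_, ?_, ?_, ?_⟩, Or.inl hp, ?_⟩,
      Or.inr hx', ?_⟩
    · exact hs.isOpen.union h'.isOpen
    · exact (IsPreconnected.union (F y).2 hyJ hy.1 hs.ordConnected.isPreconnected
        h'.ordConnected.isPreconnected).ordConnected
    · have hcover : (univ ×ˢ (J ∪ J') : Set (ℝ × ℝ)) = univ ×ˢ J ∪ univ ×ˢ J' := prod_union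
      rw [hcover]
      refine ContinuousOn.union_of_isOpen (hs.continuousOn.congr fun z hz => if_pos hz.2)
        (h'.continuousOn.congr fun z hz => ?_) (isOpen_univ.prod hs.isOpen)
        (isOpen_univ.prod h'.isOpen)
      by_cases hzJ : z.2 ∈ J
      · simp only [hzJ, if_true]
        exact heq ⟨mem_univ _, hzJ, hz.2⟩
      · simp only [hzJ, if_false]
    · intro z hz
      by_cases hzJ : z.2 ∈ J
      · simp only [hzJ, if_true]
        exact hs.right_inv z ⟨mem_univ _, hzJ⟩
      · simp only [hzJ, if_false]
        exact h'.right_inv z ⟨mem_univ _, hz.2.resolve_left hzJ⟩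
    · simp only [hp, if_true, hpσ]
    · by_cases hzJ : (F x).2 ∈ J
      · simp only [hzJ, if_true]
        rw [← hσ']
        have := heq (x := F x) ⟨mem_univ _, hzJ, hx'⟩
        rw [hσ', this, hσ']
      · simp only [hzJ, if_false, hσ']
  have hW : W = univ := IsClopen.eq_univ ⟨hWc, hWo⟩ ⟨p, hWp⟩
  have hinj : Function.Injective F := by
    intro x y hxy
    obtain ⟨s, hs, hx, hsx⟩ : x ∈ W := hW ▸ mem_univ x
    obtain ⟨s', hs', hy, hsy⟩ : y ∈ W := hW ▸ mem_univ y
    -- Both sections pass through `p`, so they coincide over the common strip, which contains `F x =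
    -- F y`.
    have := hs.1.eqOn hF hs'.1 (z := F p) ⟨hs.2.1, hs'.2.1⟩ (hs.2.2.trans hs'.2.2.symm)
    rw [← hsx, ← hsy, ← hxy]
    exact this ⟨mem_univ _, hx, hxy ▸ hy⟩
  have hcont2 : Continuous fun x => (F x).2 := continuous_snd.comp hF.continuous
  refine ⟨hinj, range fun x => (F x).2, ?_, ?_, ⟨_, p, rfl⟩, ?_⟩
  · exact (isOpenMap_snd.comp hF.isOpenMap).isOpen_range
  · exact (isPreconnected_range hcont2).ordConnected
  · ext z
    constructor
    · rintro ⟨x, rfl⟩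
      exact ⟨mem_univ _, x, rfl⟩
    · rintro ⟨-, x, hx⟩
      refine ⟨Φ (z.1 - (F x).1) x, ?_⟩
      rw [hΦF]
      ext
      · simp
      · exact hx

end Strip

/-! ### Affine transformations in coordinates -/

theorem AffPlane.ext_iff {z w : AffPlane} : z = w ↔ z 0 = w 0 ∧ z 1 = w 1 := by
  constructor
  · rintro rfl
    exact ⟨rfl, rfl⟩
  · rintro ⟨h0, h1⟩
    ext i
    fin_cases i
    exacts [h0, h1]

theorem LinearMap.affPlane_coord (L : AffPlane →ₗ[ℝ] AffPlane) (v : AffPlane) (i : Fin 2) :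
    L v i = L !₂[1, 0] i * v 0 + L !₂[0, 1] i * v 1 := by
  have hv : v = v 0 • !₂[(1 : ℝ), 0] + v 1 • !₂[(0 : ℝ), 1] := by
    rw [AffPlane.ext_iff]
    simp
  conv_lhs => rw [hv]
  simp only [map_add, map_smul, PiLp.add_apply, PiLp.smul_apply, smul_eq_mul]
  ring

theorem AffineEquiv.apply_eq_linear_add (A : AffPlane ≃ᵃ[ℝ] AffPlane) (z : AffPlane) :
    A z = A.linear z + A 0 := by
  have := A.map_vadd 0 z
  simpa using this

theorem AffineEquiv.apply_add (A : AffPlane ≃ᵃ[ℝ] AffPlane) (z v : AffPlane) :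
    A (z + v) = A z + A.linear v := by
  rw [A.apply_eq_linear_add, A.apply_eq_linear_add z, map_add]
  abel

/-- The affine transformation `(x, y) ↦ (a x + b y + e, c x + d y + f)`. -/
noncomputable def affOfCoords (a b c d e f : ℝ) (h : a * d - b * c ≠ 0) :
    AffPlane ≃ᵃ[ℝ] AffPlane where
  toFun z := !₂[a * z 0 + b * z 1 + e, c * z 0 + d * z 1 + f]
  invFun z := !₂[(d * (z 0 - e) - b * (z 1 - f)) / (a * d - b * c),
    (a * (z 1 - f) - c * (z 0 - e)) / (a * d - b * c)]
  left_inv z := by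
    rw [AffPlane.ext_iff]
    simp only [Matrix.cons_val_zero, Matrix.cons_val_one]
    constructor <;> rw [div_eq_iff h] <;> ring
  right_inv z := by
    rw [AffPlane.ext_iff]
    simp only [Matrix.cons_val_zero, Matrix.cons_val_one]
    constructor
    · linear_combination (z 0 - e) * mul_inv_cancel₀ h
    · linear_combination (z 1 - f) * mul_inv_cancel₀ h
  linear := LinearEquiv.ofLinearMap
    { toFun := fun z => !₂[a * z 0 + b * z 1, c * z 0 + d * z 1]
      map_add' := fun z w => by rw [AffPlane.ext_iff]; simp; constructor <;> ring
      map_smul' := fun t z => by rw [AffPlane.ext_iff]; simp; constructor <;> ring }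
    { toFun := fun z => !₂[(d * z 0 - b * z 1) / (a * d - b * c),
        (a * z 1 - c * z 0) / (a * d - b * c)]
      map_add' := fun z w => by rw [AffPlane.ext_iff]; simp; constructor <;> ring
      map_smul' := fun t z => by rw [AffPlane.ext_iff]; simp; constructor <;> ring }
    (by
      ext z : 1
      rw [AffPlane.ext_iff]
      simp
      constructor
      · linear_combination z 0 * mul_inv_cancel₀ h
      · linear_combination z 1 * mul_inv_cancel₀ h)
    (by
      ext z : 1
      rw [AffPlane.ext_iff]
      simp
      constructor
      · linear_combination z 0 * mul_inv_cancel₀ h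
      · linear_combination z 1 * mul_inv_cancel₀ h)
  map_vadd' z v := by
    rw [AffPlane.ext_iff]
    simp
    constructor <;> ring

theorem affOfCoords_zero {a b c d e f : ℝ} (h : a * d - b * c ≠ 0) (z : AffPlane) :
    affOfCoords a b c d e f h z 0 = a * z 0 + b * z 1 + e := rfl

theorem affOfCoords_one {a b c d e f : ℝ} (h : a * d - b * c ≠ 0) (z : AffPlane) :
    affOfCoords a b c d e f h z 1 = c * z 0 + d * z 1 + f := rfl

/-- The affine plane as a product. -/
noncomputable def affPlaneHomeo : AffPlane ≃ₜ ℝ × ℝ where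
  toFun z := (z 0, z 1)
  invFun p := !₂[p.1, p.2]
  left_inv z := by rw [AffPlane.ext_iff]; simp
  right_inv p := by simp
  continuous_toFun := by fun_prop
  continuous_invFun := by fun_prop

/-! ### Commuting affine transformations -/

theorem exists_combination_of_not_parallel {e w : AffPlane} (he : e ≠ 0)
    (h : ¬ ∃ l : ℝ, w = l • e) (u : AffPlane) : ∃ x y : ℝ, u = x • e + y • w := by
  have hΔ : e 0 * w 1 - e 1 * w 0 ≠ 0 := by
    intro h0
    apply h
    by_cases h1 : e 0 = 0
    · have h2 : e 1 ≠ 0 := fun h2 => he (AffPlane.ext_iff.2 ⟨h1, h2⟩)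
      refine ⟨w 1 / e 1, AffPlane.ext_iff.2 ⟨?_, ?_⟩⟩
      · simp only [h1, zero_mul, zero_sub, neg_eq_zero, mul_eq_zero, h2, false_or] at h0
        simp [h0, h1]
      · simp [h2]
    · refine ⟨w 0 / e 0, AffPlane.ext_iff.2 ⟨by simp [h1], ?_⟩⟩
      simp only [PiLp.smul_apply, smul_eq_mul]
      field_simp
      linarith
  refine ⟨(u 0 * w 1 - u 1 * w 0) / (e 0 * w 1 - e 1 * w 0),
    (e 0 * u 1 - e 1 * u 0) / (e 0 * w 1 - e 1 * w 0), AffPlane.ext_iff.2 ⟨?_, ?_⟩⟩ <;>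
  simp only [PiLp.add_apply, PiLp.smul_apply, smul_eq_mul]
  · linear_combination (-u 0) * mul_inv_cancel₀ hΔ
  · linear_combination (-u 1) * mul_inv_cancel₀ hΔ

/-- Two independent fixed vectors would make `T` the identity. Applied to commuting maps, this turns
a fixed vector of one into an eigenvector of the other. -/
theorem exists_smul_of_fixed {T : AffPlane →ₗ[ℝ] AffPlane} (hT : T ≠ LinearMap.id)
    {e w : AffPlane} (he : e ≠ 0) (hTe : T e = e) (hTw : T w = w) : ∃ l : ℝ, w = l • e := by
  by_contra h
  apply hT
  ext1 u
  obtain ⟨x, y, rfl⟩ := exists_combination_of_not_parallel he h u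
  simp [hTe, hTw]

/-- A family of linear endomorphisms of the plane which is commutative and closed under products,
and whose members all have a non-zero fixed vector, has a common non-zero fixed vector. -/
theorem exists_common_fixed_vector {Γ : Type*} (L : Γ → AffPlane →ₗ[ℝ] AffPlane)
    (hcomm : ∀ i j v, L i (L j v) = L j (L i v)) (hmul : ∀ i j, ∃ k, ∀ v, L k v = L i (L j v))
    (hfix : ∀ i, ∃ v, v ≠ 0 ∧ L i v = v) : ∃ v, v ≠ 0 ∧ ∀ i, L i v = v := by
  by_contra! hno
  have hne : ∃ i, L i ≠ LinearMap.id := by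
    by_contra! hid
    obtain ⟨i, hi⟩ := hno !₂[1, 0] (by rw [Ne, AffPlane.ext_iff]; simp)
    exact hi (by rw [hid]; rfl)
  obtain ⟨i, hi⟩ := hne
  obtain ⟨e, he, hie⟩ := hfix i
  obtain ⟨j, hj⟩ := hno e he
  obtain ⟨v, hv, hjv⟩ := hfix j
  have hjid : L j ≠ LinearMap.id := fun h => hj (by rw [h]; rfl)
  obtain ⟨l, hl⟩ := exists_smul_of_fixed hi he hie (w := L j e) (by rw [hcomm, hie])
  obtain ⟨m, hm⟩ := exists_smul_of_fixed hjid hv hjv (w := L i v) (by rw [hcomm, hjv])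
  have hl1 : l ≠ 1 := fun h => hj (by rw [hl, h, one_smul])
  have hpar : ¬ ∃ t : ℝ, v = t • e := by
    rintro ⟨t, rfl⟩
    have ht : t ≠ 0 := fun h => hv (by rw [h, zero_smul])
    rw [map_smul, hl, smul_comm] at hjv
    have h2 : (l - 1) • t • e = 0 := by rw [sub_smul, hjv, one_smul, sub_self]
    rcases smul_eq_zero.1 h2 with h3 | h3
    · exact hl1 (by linarith)
    · exact hv h3
  have hm1 : m ≠ 1 := by
    rintro rfl
    apply hi
    ext1 u
    obtain ⟨x, y, rfl⟩ := exists_combination_of_not_parallel he hpar u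
    simp [hie, hm]
  -- In the basis `e`, `v` the product of `L i` and `L j` is diagonal with entries `l`, `m`, both
  -- different from `1`. It therefore fixes no nonzero vector, contrary to `hfix`.
  obtain ⟨k, hk⟩ := hmul i j
  obtain ⟨w, hw, hkw⟩ := hfix k
  obtain ⟨x, y, rfl⟩ := exists_combination_of_not_parallel he hpar w
  rw [hk] at hkw
  simp only [map_add, map_smul, hl, hjv, hie, hm] at hkw
  have h1 : (x * (l - 1)) • e + (y * (m - 1)) • v = 0 := by
    have : (x * (l - 1)) • e + (y * (m - 1)) • v =
      (x • l • e + y • m • v) - (x • e + y • v) := by module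
    rw [this, hkw, sub_self]
  by_cases hy : y = 0
  · subst hy
    simp only [zero_mul, zero_smul, add_zero] at h1 hw
    rcases smul_eq_zero.1 h1 with h2 | h2
    · rcases mul_eq_zero.1 h2 with h3 | h3
      · exact hw (by rw [h3, zero_smul])
      · exact hl1 (by linarith)
    · exact he h2
  · have hym : y * (m - 1) ≠ 0 := mul_ne_zero hy (sub_ne_zero.2 hm1)
    apply hpar
    refine ⟨-(y * (m - 1))⁻¹ * (x * (l - 1)), ?_⟩
    have h2 : (y * (m - 1)) • v = -((x * (l - 1)) • e) := by
      rw [eq_neg_iff_add_eq_zero, add_comm, h1]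
    rw [mul_smul, neg_smul, ← smul_neg, ← h2, inv_smul_smul₀ hym]

/-- Commuting affine transformations of the plane either have a common fixed point, or their
linear parts have a common non-zero fixed vector. -/
theorem exists_fixed_point_or_vector {Γ : Type*} (h : Γ → AffPlane ≃ᵃ[ℝ] AffPlane)
    (hcomm : ∀ i j z, h i (h j z) = h j (h i z)) (hmul : ∀ i j, ∃ k, ∀ z, h k z = h i (h j z)) :
    (∃ z, ∀ i, h i z = z) ∨ ∃ v, v ≠ 0 ∧ ∀ i, (h i).linear v = v := by
  have hlin : ∀ i v, (h i).linear v = h i v - h i 0 := fun i v => by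
    rw [(h i).apply_eq_linear_add v]; abel
  by_cases hfix : ∀ i, ∃ v, v ≠ 0 ∧ (h i).linear v = v
  · right
    refine exists_common_fixed_vector (fun i => ((h i).linear : AffPlane →ₗ[ℝ] AffPlane))
      (fun i j v => ?_) (fun i j => ?_) hfix
    · have h1 : ∀ i j v, h i (h j v) = (h i).linear ((h j).linear v) + h i (h j 0) := by
        intro i j v
        rw [(h j).apply_eq_linear_add v, add_comm, (h i).apply_add, add_comm]
      have h2 := hcomm i j v
      rw [h1 i j, h1 j i, hcomm i j 0] at h2
      exact add_right_cancel h2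
    · obtain ⟨k, hk⟩ := hmul i j
      refine ⟨k, fun v => ?_⟩
      simp only [LinearEquiv.coe_coe]
      rw [hlin k, hk, hk, (h j).apply_eq_linear_add v, add_comm, (h i).apply_add]
      abel
  · left
    push Not at hfix
    -- Here the linear part of `h i` minus the identity is invertible, so `h i` has exactly one
    -- fixed point, and every map commuting with `h i` must fix it.
    obtain ⟨i, hi⟩ := hfix
    let T : AffPlane →ₗ[ℝ] AffPlane := (h i).linear.toLinearMap - LinearMap.id
    have hinj : Function.Injective T := by
      rw [injective_iff_map_eq_zero]
      intro v hv
      by_contra hv0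
      exact hi v hv0 (sub_eq_zero.1 hv)
    obtain ⟨z, hz⟩ := LinearMap.injective_iff_surjective.1 hinj (-(h i 0))
    have hz' : (h i).linear z - z = -(h i 0) := hz
    have hiz : h i z = z := by
      rw [(h i).apply_eq_linear_add]
      have : (h i).linear z = z + -(h i 0) := by rw [← hz']; abel
      rw [this]; abel
    refine ⟨z, fun j => ?_⟩
    have h1 : h i (h j z) = h j z := by rw [hcomm, hiz]
    have h2 : T (h j z - z) = 0 := by
      change (h i).linear (h j z - z) - (h j z - z) = 0
      rw [map_sub, hlin i, hlin i, h1, hiz]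
      abel
    exact sub_eq_zero.1 ((injective_iff_map_eq_zero _).1 hinj _ h2)

/-! ### Developing maps of tori -/

/-- `D` is an immersion of the plane, equivariant for the lattice translations and the affine
transformations `h`. -/
structure IsTorusDev (D : ℝ × ℝ → AffPlane) (h : ℤ × ℤ → AffPlane ≃ᵃ[ℝ] AffPlane) : Prop where
  isLocalHomeomorph : IsLocalHomeomorph D
  apply_latticeShift : ∀ γ x, D (latticeShift γ x) = h γ (D x)

namespace IsTorusDev

variable {D : ℝ × ℝ → AffPlane} {h : ℤ × ℤ → AffPlane ≃ᵃ[ℝ] AffPlane}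

/-- The image of `D` contains an open set, and on it equivariance determines the affine map. -/
theorem apply_add (hD : IsTorusDev D h) (γ γ' : ℤ × ℤ) (z : AffPlane) :
    h (γ + γ') z = h γ (h γ' z) := by
  have : h (γ + γ') = (h γ').trans (h γ) := by
    refine AffineEquiv.eq_of_comp_eventuallyEq (ψ := D) (x := 0)
      (hD.isLocalHomeomorph.isOpenMap.nhds_le 0) ?_
    filter_upwards with x
    rw [← hD.apply_latticeShift, latticeShift_add, hD.apply_latticeShift, hD.apply_latticeShift]
    rfl
  rw [this]
  rfl

theorem comm (hD : IsTorusDev D h) (γ γ' : ℤ × ℤ) (z : AffPlane) :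
    h γ (h γ' z) = h γ' (h γ z) := by
  rw [← hD.apply_add, add_comm, hD.apply_add]

theorem apply_neg (hD : IsTorusDev D h) (γ : ℤ × ℤ) (z : AffPlane) : h (-γ) (h γ z) = z := by
  have h0 : ∀ z, h 0 z = z := fun z => (h 0).injective (by rw [← hD.apply_add, add_zero])
  rw [← hD.apply_add, neg_add_cancel, h0]

theorem comp (hD : IsTorusDev D h) (A : AffPlane ≃ᵃ[ℝ] AffPlane) :
    IsTorusDev (fun x => A (D x)) (fun γ => A.symm.trans ((h γ).trans A)) where
  isLocalHomeomorph := by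
    let A' : AffPlane ≃ₜ AffPlane :=
      ⟨A.toEquiv, A.continuous_affPlane, A.symm.continuous_affPlane⟩
    exact A'.isLocalHomeomorph.comp hD.isLocalHomeomorph
  apply_latticeShift γ x := by simp [hD.apply_latticeShift]

/-- A flow commuting with the holonomy lifts. -/
theorem exists_lift_flow (hD : IsTorusDev D h) {φ : ℝ → AffPlane → AffPlane} (hφ : IsFlow φ)
    (hφh : ∀ γ t z, φ t (h γ z) = h γ (φ t z)) :
    ∃ Φ : ℝ → ℝ × ℝ → ℝ × ℝ, (Continuous fun p : ℝ × (ℝ × ℝ) => Φ p.1 p.2) ∧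
      (∀ x, Φ 0 x = x) ∧ ∀ t x, D (Φ t x) = φ t (D x) :=
  _root_.exists_lift_flow hD.isLocalHomeomorph hφ (τ := latticeShift) isCompact_Icc
    exists_latticeShift_mem_Icc (H := fun γ => (h γ).toEquiv) hD.apply_latticeShift hφh

end IsTorusDev

/-- Up to an affine transformation, `D` is an embedding onto the plane, the half-plane or the
quadrant, or it is the developing map of the universal covering of the punctured plane. -/
def IsStandardDev (D : ℝ × ℝ → AffPlane) : Prop :=
  ∃ A : AffPlane ≃ᵃ[ℝ] AffPlane,
    (Function.Injective D ∧ ((range fun x => A (D x)) = univ ∨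
      (range fun x => A (D x)) = affHalfPlane ∨ (range fun x => A (D x)) = affQuadrant)) ∨
    ∃ F : ℝ × ℝ ≃ₜ PuncturedPlaneCover, ∀ x, PuncturedPlaneCover.dev (F x) = A (D x)

theorem IsStandardDev.of_comp {D : ℝ × ℝ → AffPlane} (B : AffPlane ≃ᵃ[ℝ] AffPlane)
    (h : IsStandardDev fun x => B (D x)) : IsStandardDev D := by
  obtain ⟨A, h⟩ := h
  refine ⟨B.trans A, ?_⟩
  rcases h with ⟨hi, h⟩ | h
  · exact Or.inl ⟨fun x y hxy => hi (congrArg B hxy), h⟩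
  · exact Or.inr h

/-! ### Lattices do not act properly on a line -/

theorem exists_int_combination_lt (a b : ℝ) {ε : ℝ} (hε : 0 < ε) :
    ∃ γ : ℤ × ℤ, γ ≠ 0 ∧ |γ.1 * a + γ.2 * b| < ε := by
  by_cases hb : b = 0
  · exact ⟨(0, 1), by simp, by simpa [hb] using hε⟩
  · obtain ⟨n, hn⟩ := exists_nat_gt (|b| / ε)
    have hn0 : (0 : ℝ) < n := lt_of_le_of_lt (by positivity) hn
    obtain ⟨j, k, hk, -, hjk⟩ := Real.exists_int_int_abs_mul_sub_le (a / b) (n := n)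
      (by exact_mod_cast hn0)
    refine ⟨(k, -j), fun h => hk.ne' (congrArg Prod.fst h), ?_⟩
    have h1 : ((k : ℤ) : ℝ) * a + ((-j : ℤ) : ℝ) * b = (k * (a / b) - j) * b := by
      push_cast
      field_simp
      ring
    rw [h1, abs_mul]
    have h2 : |(k : ℝ) * (a / b) - j| * |b| ≤ 1 / (n + 1) * |b| :=
      mul_le_mul_of_nonneg_right hjk (abs_nonneg _)
    refine h2.trans_lt ?_
    rw [div_lt_iff₀ hε] at hn
    rw [one_div, inv_mul_lt_iff₀ (by positivity)]
    nlinarith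

/-- The translation lengths form a homomorphism from `ℤ × ℤ` to `ℝ`, which takes arbitrarily small
values at nonzero elements. Since `F` is injective and open, such an element would move `p` by a
small amount, whereas lattice vectors are bounded away from zero. Only the doubles `γ + γ` are
required to translate, because in polar coordinates single elements may reverse orientation. -/
theorem not_latticeShift_preserves_line {F : ℝ × ℝ → ℝ × ℝ} (hF : IsLocalHomeomorph F)
    (hinj : Function.Injective F) {y₀ : ℝ} (hy₀ : ∃ p, (F p).2 = y₀) (u : ℤ × ℤ → ℝ)
    (hu : ∀ γ p, (F p).2 = y₀ → F (latticeShift (γ + γ) p) = ((F p).1 + u γ, y₀)) : False := by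
  obtain ⟨p, hp⟩ := hy₀
  have hadd : ∀ γ γ', u (γ + γ') = u γ + u γ' := by
    intro γ γ'
    have h1 := hu (γ + γ') p hp
    have h3 := hu γ' p hp
    have h2 := hu γ (latticeShift (γ' + γ') p) (by rw [h3])
    rw [← latticeShift_add, h3, show γ + γ + (γ' + γ') = γ + γ' + (γ + γ') by abel, h1] at h2
    have := congrArg Prod.fst h2
    simp only at this
    linarith
  let U : ℤ × ℤ →+ ℝ := AddMonoidHom.mk' u hadd
  have hU : ∀ γ : ℤ × ℤ, u γ = γ.1 * u (1, 0) + γ.2 * u (0, 1) := by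
    intro γ
    have h1 : γ = γ.1 • ((1, 0) : ℤ × ℤ) + γ.2 • ((0, 1) : ℤ × ℤ) := by ext <;> simp
    change U γ = γ.1 * U (1, 0) + γ.2 * U (0, 1)
    conv_lhs => rw [h1]
    rw [map_add, map_zsmul, map_zsmul]
    simp
  have hnhds : F '' (Metric.ball p 1) ∈ 𝓝 (F p) :=
    hF.isOpenMap.image_mem_nhds (Metric.ball_mem_nhds p one_pos)
  have hc : ∀ᶠ t : ℝ in 𝓝 0, ((F p).1 + t, (F p).2) ∈ F '' (Metric.ball p 1) := by
    have : Continuous fun t : ℝ => ((F p).1 + t, (F p).2) := by fun_prop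
    have h0 := this.tendsto 0
    rw [add_zero] at h0
    exact h0.eventually hnhds
  obtain ⟨ε, hε, hball⟩ := Metric.eventually_nhds_iff.1 hc
  obtain ⟨γ, hγ0, hγ⟩ := exists_int_combination_lt (u (1, 0)) (u (0, 1)) hε
  rw [← hU] at hγ
  obtain ⟨x, hx, hxF⟩ := hball (y := u γ) (by simpa using hγ)
  rw [hp, ← hu γ p hp] at hxF
  have hx' := hinj hxF
  subst hx'
  rw [Metric.mem_ball, latticeShift_apply, Prod.dist_eq, max_lt_iff] at hx
  simp only [Real.dist_eq, add_sub_cancel_left, Prod.fst_add, Prod.snd_add] at hx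
  have key : ∀ n : ℤ, |2 * Real.pi * ((n + n : ℤ) : ℝ)| < 1 → n = 0 := by
    intro n hn
    by_contra hn0
    have h1 : (1 : ℝ) ≤ |(n : ℝ)| := by exact_mod_cast Int.one_le_abs hn0
    have h2 : |2 * Real.pi * ((n + n : ℤ) : ℝ)| = 4 * Real.pi * |(n : ℝ)| := by
      push_cast
      rw [← two_mul, ← mul_assoc, abs_mul, abs_of_pos (by positivity)]
      ring
    rw [h2] at hn
    nlinarith [Real.pi_gt_three]
  exact hγ0 (Prod.ext (key _ hx.1) (key _ hx.2))

/-! ### Holonomy whose linear part fixes a vector -/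

/-- An interval which is invariant under `s ↦ ρ s` and its inverse, `1 < ρ`, and contains a
positive number, contains all positive numbers. -/
theorem Ioi_subset_of_mul_invariant {K : Set ℝ} (hK : K.OrdConnected) {ρ : ℝ} (hρ : 1 < ρ)
    (h1 : ∀ s ∈ K, ρ * s ∈ K) (h2 : ∀ s ∈ K, ρ⁻¹ * s ∈ K) {s : ℝ} (hs : s ∈ K) (hs0 : 0 < s) :
    Ioi 0 ⊆ K := by
  intro w hw
  have hw : 0 < w := hw
  have k1 : ∀ n : ℕ, ρ ^ n * s ∈ K := by
    intro n
    induction n with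
    | zero => simpa using hs
    | succ n ih => rw [pow_succ', mul_assoc]; exact h1 _ ih
  have k2 : ∀ n : ℕ, ρ⁻¹ ^ n * s ∈ K := by
    intro n
    induction n with
    | zero => simpa using hs
    | succ n ih => rw [pow_succ', mul_assoc]; exact h2 _ ih
  obtain ⟨n, hn⟩ := pow_unbounded_of_one_lt (w / s) hρ
  obtain ⟨m, hm⟩ := exists_pow_lt_of_lt_one (div_pos hw hs0) (inv_lt_one_of_one_lt₀ hρ)
  rw [div_lt_iff₀ hs0] at hn
  rw [lt_div_iff₀ hs0] at hm
  exact hK.out (k2 m) (k1 n) ⟨hm.le, hn.le⟩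

theorem eq_univ_of_add_invariant {J : Set ℝ} (hJ : J.OrdConnected) (hne : J.Nonempty) {d : ℝ}
    (hd : d ≠ 0) (h1 : ∀ y ∈ J, y + d ∈ J) (h2 : ∀ y ∈ J, y - d ∈ J) : J = univ := by
  wlog hd0 : 0 < d generalizing d
  · exact this (d := -d) (by simpa using hd) (fun y hy => by simpa [← sub_eq_add_neg] using h2 y hy)
      (fun y hy => by simpa using h1 y hy) (by
        have : d < 0 := lt_of_le_of_ne (not_lt.1 hd0) hd
        linarith)
  obtain ⟨y, hy⟩ := hne
  have k1 : ∀ n : ℕ, y + n * d ∈ J := by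
    intro n
    induction n with
    | zero => simpa using hy
    | succ n ih =>
      have := h1 _ ih
      rwa [add_assoc, ← add_one_mul, ← Nat.cast_succ] at this
  have k2 : ∀ n : ℕ, y - n * d ∈ J := by
    intro n
    induction n with
    | zero => simpa using hy
    | succ n ih =>
      have := h2 _ ih
      rwa [sub_sub, ← add_one_mul, ← Nat.cast_succ] at this
  refine eq_univ_of_forall fun w => ?_
  obtain ⟨n, hn⟩ := exists_nat_gt ((w - y) / d)
  obtain ⟨m, hm⟩ := exists_nat_gt ((y - w) / d)
  rw [div_lt_iff₀ hd0] at hn hm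
  exact hJ.out (k2 m) (k1 n) ⟨by linarith, by linarith⟩

/-- The horizontal translation flow. -/
theorem isFlow_horizontal : IsFlow fun (t : ℝ) (z : AffPlane) => z + t • !₂[(1 : ℝ), 0] where
  continuous := by fun_prop
  zero z := by simp
  add s t z := by rw [add_smul]; abel

/-- If the holonomy acts trivially on the second coordinate, that coordinate would be an open
function on a compact space. -/
theorem not_forall_snd_latticeShift_eq {F : ℝ × ℝ → ℝ × ℝ} (hF : IsLocalHomeomorph F)
    (h : ∀ γ x, (F (latticeShift γ x)).2 = (F x).2) : False := by
  have hc : Continuous fun x => (F x).2 := continuous_snd.comp hF.continuous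
  have ho : IsOpen (range fun x => (F x).2) := (isOpenMap_snd.comp hF.isOpenMap).isOpen_range
  have hcomp : IsCompact (range fun x => (F x).2) := by
    have : (range fun x => (F x).2) =
        (fun x => (F x).2) '' Icc (0 : ℝ × ℝ) (2 * Real.pi, 2 * Real.pi) := by
      refine Subset.antisymm ?_ (image_subset_range _ _)
      rintro _ ⟨x, rfl⟩
      obtain ⟨γ, hγ⟩ := exists_latticeShift_mem_Icc x
      exact ⟨_, hγ, h γ x⟩
    rw [this]
    exact isCompact_Icc.image hc
  have huniv : (range fun x => (F x).2) = univ :=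
    IsClopen.eq_univ ⟨hcomp.isClosed, ho⟩ (range_nonempty _)
  rw [huniv] at hcomp
  exact noncompact_univ ℝ hcomp

/-- A strip image over an invariant half-line. -/
theorem isStandardDev_of_halfLine {D : ℝ × ℝ → AffPlane} (hinj : Function.Injective D) {J : Set ℝ}
    (hrange : ∀ z : AffPlane, z ∈ range D ↔ z 1 ∈ J) {s y₀ : ℝ} (hs : s ≠ 0)
    (hJ : ∀ y, y ∈ J ↔ 0 < s * (y - y₀)) : IsStandardDev D := by
  have hdet : (1 : ℝ) * s - 0 * 0 ≠ 0 := by simpa using hs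
  refine ⟨affOfCoords 1 0 0 s 0 (-(s * y₀)) hdet, Or.inl ⟨hinj, Or.inr (Or.inl ?_)⟩⟩
  set A := affOfCoords 1 0 0 s 0 (-(s * y₀)) hdet
  have hA : ∀ z, A z 1 = s * (z 1 - y₀) := fun z => by
    rw [affOfCoords_one]; ring
  ext w
  change _ ↔ 0 < w 1
  constructor
  · rintro ⟨x, rfl⟩
    change 0 < A (D x) 1
    rw [hA, ← hJ, ← hrange]
    exact ⟨x, rfl⟩
  · intro hw
    have : A.symm w ∈ range D := by
      rw [hrange, hJ, ← hA, AffineEquiv.apply_symm_apply]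
      exact hw
    obtain ⟨x, hx⟩ := this
    exact ⟨x, by simp [hx]⟩

/-- Translations along the first axis commute with the holonomy, so `D` embeds onto a strip over an
interval `J` on which the holonomy acts by `y ↦ χ y + d`. The three cases are a nontrivial `χ`,
trivial `χ` with a nonzero `d`, and trivial action. -/
theorem IsTorusDev.isStandardDev_of_linear_fixes_horizontal {D : ℝ × ℝ → AffPlane}
    {h : ℤ × ℤ → AffPlane ≃ᵃ[ℝ] AffPlane} (hD : IsTorusDev D h)
    (hfix : ∀ γ, (h γ).linear !₂[1, 0] = !₂[1, 0]) : IsStandardDev D := by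
  obtain ⟨Φ, hΦc, hΦ0, hΦD⟩ := hD.exists_lift_flow isFlow_horizontal (fun γ t z => by
    rw [(h γ).apply_add, map_smul, hfix])
  set F : ℝ × ℝ → ℝ × ℝ := fun x => affPlaneHomeo (D x) with hFdef
  have hF : IsLocalHomeomorph F := affPlaneHomeo.isLocalHomeomorph.comp hD.isLocalHomeomorph
  have hF1 : ∀ x, (F x).1 = D x 0 := fun x => rfl
  have hF2 : ∀ x, (F x).2 = D x 1 := fun x => rfl
  obtain ⟨hinj, J, hJo, hJc, hJne, hJr⟩ := injective_and_range_of_horizontal_flow hF hΦc hΦ0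
    (fun t x => by
      ext
      · simp [hF1, hΦD]
      · simp [hF2, hΦD])
  have hDinj : Function.Injective D := fun x y hxy => hinj (congrArg affPlaneHomeo hxy)
  have hrange : ∀ z : AffPlane, z ∈ range D ↔ z 1 ∈ J := by
    intro z
    constructor
    · rintro ⟨x, rfl⟩
      have : F x ∈ univ ×ˢ J := hJr ▸ mem_range_self x
      exact this.2
    · intro hz
      have : affPlaneHomeo z ∈ range F := by
        rw [hJr]
        exact ⟨mem_univ _, hz⟩
      obtain ⟨x, hx⟩ := this
      exact ⟨x, affPlaneHomeo.injective hx⟩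
  have hmem : ∀ x, D x 1 ∈ J := fun x => (hrange _).1 ⟨x, rfl⟩
  have hsurj : ∀ y ∈ J, ∃ x, D x 1 = y := by
    intro y hy
    obtain ⟨x, hx⟩ := (hrange !₂[0, y]).2 (by simpa using hy)
    exact ⟨x, by rw [hx]; simp⟩
  obtain ⟨β, c, χ, d, h0, h1⟩ : ∃ β c χ d : ℤ × ℤ → ℝ,
      (∀ γ z, h γ z 0 = z 0 + β γ * z 1 + c γ) ∧ ∀ γ z, h γ z 1 = χ γ * z 1 + d γ := by
    refine ⟨fun γ => (h γ).linear !₂[0, 1] 0, fun γ => h γ 0 0,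
      fun γ => (h γ).linear !₂[0, 1] 1, fun γ => h γ 0 1, fun γ z => ?_, fun γ z => ?_⟩
    · rw [(h γ).apply_eq_linear_add, PiLp.add_apply]
      have := ((h γ).linear.toLinearMap).affPlane_coord z 0
      simp only [LinearEquiv.coe_coe, hfix] at this
      rw [this]
      simp
    · rw [(h γ).apply_eq_linear_add, PiLp.add_apply]
      have := ((h γ).linear.toLinearMap).affPlane_coord z 1
      simp only [LinearEquiv.coe_coe, hfix] at this
      rw [this]
      simp
  have hJinv : ∀ γ, ∀ y ∈ J, χ γ * y + d γ ∈ J := by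
    intro γ y hy
    obtain ⟨x, rfl⟩ := hsurj y hy
    rw [← h1, ← hD.apply_latticeShift]
    exact hmem _
  have hneg : ∀ γ y, χ (-γ) * (χ γ * y + d γ) + d (-γ) = y := by
    intro γ y
    have := hD.apply_neg γ !₂[0, y]
    have := congrArg (fun z : AffPlane => z 1) this
    simpa [h1] using this
  by_cases hχ : ∃ γ, χ γ ≠ 1
  · obtain ⟨γ₀, hγ₀⟩ := hχ
    have hγ₀' : 1 - χ γ₀ ≠ 0 := fun h => hγ₀ (by linarith)
    set y₀ := d γ₀ / (1 - χ γ₀) with hy₀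
    have hy₀fix : χ γ₀ * y₀ + d γ₀ = y₀ := by
      have : y₀ * (1 - χ γ₀) = d γ₀ := div_mul_cancel₀ _ hγ₀'
      linarith
    -- The fixed height of one nontrivial homothety of the line is unique, so it is shared by the
    -- commuting ones.
    have hfixall : ∀ γ, χ γ * y₀ + d γ = y₀ := by
      intro γ
      have h2 := congrArg (fun z : AffPlane => z 1) (hD.comm γ₀ γ !₂[0, y₀])
      simp only [h1] at h2
      have h3 : (![0, y₀] : Fin 2 → ℝ) 1 = y₀ := rfl
      rw [h3, hy₀fix] at h2
      have h4 : (1 - χ γ₀) * (χ γ * y₀ + d γ - y₀) = 0 := by linear_combination -h2 + hy₀fix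
      have := (mul_eq_zero.1 h4).resolve_left hγ₀'
      linarith
    have hact : ∀ γ y, χ γ * y + d γ - y₀ = χ γ * (y - y₀) := fun γ y => by
      linear_combination hfixall γ
    by_cases hyJ : y₀ ∈ J
    · exfalso
      refine not_latticeShift_preserves_line hF hinj (y₀ := y₀) (hsurj y₀ hyJ)
        (fun γ => β (γ + γ) * y₀ + c (γ + γ)) fun γ p hp => ?_
      rw [hF2] at hp
      ext
      · rw [hF1, hD.apply_latticeShift, h0, hp, hF1]
        ring
      · rw [hF2, hD.apply_latticeShift, h1, hp, hfixall]
    · obtain ⟨y₁, hy₁⟩ := hJne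
      have hy₁₀ : y₁ - y₀ ≠ 0 := fun h => hyJ (by rwa [← sub_eq_zero.1 h])
      -- The interval `J` in the affine coordinate with `y₀` at `0` and `y₁` at `1`. In it the
      -- holonomy acts by multiplication by `χ`.
      set K : Set ℝ := {s | y₀ + s * (y₁ - y₀) ∈ J} with hKdef
      have hK1 : (1 : ℝ) ∈ K := by simpa [hKdef] using hy₁
      have hK0 : (0 : ℝ) ∉ K := by simpa [hKdef] using hyJ
      have hKc : K.OrdConnected := by
        have : IsPreconnected K := by
          let e : ℝ ≃ₜ ℝ := (Homeomorph.mulRight₀ (y₁ - y₀) hy₁₀).trans (Homeomorph.addLeft y₀)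
          have hKe : K = e ⁻¹' J := rfl
          rw [hKe]
          exact e.isPreconnected_preimage.2 hJc.isPreconnected
        exact this.ordConnected
      have hKpos : ∀ s ∈ K, 0 < s := by
        intro s hs
        by_contra hs0
        exact hK0 (hKc.out hs hK1 ⟨not_lt.1 hs0, zero_le_one⟩)
      have hKmul : ∀ γ, ∀ s ∈ K, χ γ * s ∈ K := by
        intro γ s hs
        have := hJinv γ _ hs
        have h2 := hact γ (y₀ + s * (y₁ - y₀))
        change y₀ + χ γ * s * (y₁ - y₀) ∈ J
        convert this using 1
        linear_combination -h2
      -- The interval `K` contains `1` but not `0`, so it is positive; it also contains `χ γ = χ γ *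
      -- 1`.
      have hχpos : ∀ γ, 0 < χ γ := fun γ => by simpa using hKpos _ (hKmul γ 1 hK1)
      have hχneg : ∀ γ, χ (-γ) = (χ γ)⁻¹ := by
        intro γ
        have h2 := hneg γ 0
        have h3 := hneg γ 1
        refine eq_inv_of_mul_eq_one_left ?_
        linear_combination h3 - h2
      have hKIoi : Ioi 0 ⊆ K := by
        rcases lt_or_gt_of_ne hγ₀ with hlt | hgt
        · refine Ioi_subset_of_mul_invariant hKc (ρ := χ (-γ₀)) ?_ (hKmul _) ?_ hK1 one_pos
          · rw [hχneg]
            exact (one_lt_inv₀ (hχpos _)).2 hlt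
          · rw [← hχneg, neg_neg]
            exact hKmul _
        · refine Ioi_subset_of_mul_invariant hKc hgt (hKmul _) ?_ hK1 one_pos
          rw [← hχneg]
          exact hKmul _
      refine isStandardDev_of_halfLine hDinj hrange (s := (y₁ - y₀)⁻¹) (y₀ := y₀)
        (inv_ne_zero hy₁₀) fun y => ?_
      have hyK : y ∈ J ↔ (y₁ - y₀)⁻¹ * (y - y₀) ∈ K := by
        change _ ↔ y₀ + (y₁ - y₀)⁻¹ * (y - y₀) * (y₁ - y₀) ∈ J
        rw [mul_right_comm, inv_mul_cancel₀ hy₁₀, one_mul, add_sub_cancel]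
      rw [hyK]
      exact ⟨hKpos _, fun hpos => hKIoi hpos⟩
  · push Not at hχ
    by_cases hd : ∃ γ, d γ ≠ 0
    · obtain ⟨γ, hγ⟩ := hd
      have hdneg : d (-γ) = -d γ := by
        have := hneg γ 0
        rw [hχ, hχ] at this
        linarith
      have hJu : J = univ := eq_univ_of_add_invariant hJc hJne hγ
        (fun y hy => by simpa [hχ] using hJinv γ y hy)
        (fun y hy => by simpa [hχ, hdneg, ← sub_eq_add_neg] using hJinv (-γ) y hy)
      refine ⟨AffineEquiv.refl ℝ AffPlane, Or.inl ⟨hDinj, Or.inl ?_⟩⟩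
      refine eq_univ_of_forall fun z => ?_
      have := (hrange z).2 (hJu ▸ mem_univ _)
      simpa using this
    · push Not at hd
      exfalso
      refine not_forall_snd_latticeShift_eq hF fun γ x => ?_
      rw [hF2, hD.apply_latticeShift, h1, hχ, hd, hF2]
      ring

theorem IsTorusDev.isStandardDev_of_fixed_vector {D : ℝ × ℝ → AffPlane}
    {h : ℤ × ℤ → AffPlane ≃ᵃ[ℝ] AffPlane} (hD : IsTorusDev D h) {v : AffPlane} (hv : v ≠ 0)
    (hfix : ∀ γ, (h γ).linear v = v) : IsStandardDev D := by
  have hn : v 0 ^ 2 + v 1 ^ 2 ≠ 0 := by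
    intro hn
    have h0 : v 0 = 0 := by nlinarith [sq_nonneg (v 0), sq_nonneg (v 1)]
    have h1 : v 1 = 0 := by nlinarith [sq_nonneg (v 0), sq_nonneg (v 1)]
    exact hv (AffPlane.ext_iff.2 ⟨h0, h1⟩)
  -- The first row takes the value `1` on `v`, the second one annihilates `v`, and the determinant
  -- is `1`.
  have hdet : v 0 / (v 0 ^ 2 + v 1 ^ 2) * v 0 - v 1 / (v 0 ^ 2 + v 1 ^ 2) * (-v 1) ≠ 0 := by
    have : v 0 / (v 0 ^ 2 + v 1 ^ 2) * v 0 - v 1 / (v 0 ^ 2 + v 1 ^ 2) * (-v 1) = 1 := by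
      field_simp
      ring
    rw [this]
    exact one_ne_zero
  set A := affOfCoords (v 0 / (v 0 ^ 2 + v 1 ^ 2)) (v 1 / (v 0 ^ 2 + v 1 ^ 2)) (-v 1) (v 0) 0 0 hdet
    with hAdef
  have hAv : A.linear v = !₂[1, 0] := by
    have h1 : A.linear v = A v - A 0 := by rw [A.apply_eq_linear_add v]; abel
    rw [h1, AffPlane.ext_iff]
    simp only [PiLp.sub_apply, hAdef, affOfCoords_zero, affOfCoords_one]
    constructor
    · simp
      field_simp
    · simp
      ring
  have hAs : A.symm.linear !₂[1, 0] = v := by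
    rw [← hAv]
    exact A.linear.symm_apply_apply v
  refine IsStandardDev.of_comp A ((hD.comp A).isStandardDev_of_linear_fixes_horizontal fun γ => ?_)
  change A.linear ((h γ).linear (A.symm.linear !₂[1, 0])) = _
  rw [hAs, hfix, hAv]

/-! ### Holonomy with a fixed point: the developing map avoids it -/

/-- The homothety flow. -/
theorem isFlow_homothety : IsFlow fun (t : ℝ) (z : AffPlane) => Real.exp t • z where
  continuous := by fun_prop
  zero z := by simp
  add s t z := by rw [Real.exp_add, mul_smul]

theorem AffineEquiv.map_smul_of_fix_zero {A : AffPlane ≃ᵃ[ℝ] AffPlane} (hA : A 0 = 0) (t : ℝ)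
    (z : AffPlane) : A (t • z) = t • A z := by
  rw [A.apply_eq_linear_add, A.apply_eq_linear_add z, hA, map_smul, add_zero, add_zero]

/-- If `D x = 0`, a local inverse `e.symm` is defined on a ball about `0`. Flowing towards the
origin brings every point into its range, so `x` is the only zero of `D`. But the lattice translates
of `x` are zeros as well. -/
theorem IsTorusDev.ne_zero {D : ℝ × ℝ → AffPlane} {h : ℤ × ℤ → AffPlane ≃ᵃ[ℝ] AffPlane}
    (hD : IsTorusDev D h) (h0 : ∀ γ, h γ 0 = 0) (x : ℝ × ℝ) : D x ≠ 0 := by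
  obtain ⟨Φ, hΦc, hΦ0, hΦD⟩ := hD.exists_lift_flow isFlow_homothety (fun γ t z =>
    ((h γ).map_smul_of_fix_zero (h0 γ) _ _).symm)
  intro hp
  obtain ⟨e, hxe, heD⟩ := hD.isLocalHomeomorph x
  have heD' : ∀ y, e y = D y := fun y => by rw [heD]
  have h0t : (0 : AffPlane) ∈ e.target := by
    rw [← hp, ← heD']
    exact e.map_source hxe
  obtain ⟨r, hr, hball⟩ := Metric.isOpen_iff.1 e.open_target 0 h0t
  have hΦx : ∀ t, Continuous fun y => Φ t y := fun t => hΦc.comp (Continuous.prodMk_right t)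
  have hΦt : ∀ y, Continuous fun t => Φ t y := fun y => hΦc.comp (Continuous.prodMk_left y)
  have hmem : ∀ (t : ℝ) (z : AffPlane), Real.exp t * ‖z‖ < r →
      Real.exp t • z ∈ Metric.ball 0 r := fun t z hz => by
    rw [mem_ball_zero_iff, norm_smul, Real.norm_eq_abs, abs_of_pos (Real.exp_pos t)]
    exact hz
  -- Points whose lifted trajectory enters the sheet `e.source` while its image lies in the ball of
  -- radius `r`.
  let U : Set (ℝ × ℝ) := {y | ∃ t, Φ t y ∈ e.source ∧ Real.exp t * ‖D y‖ < r}
  have key : ∀ y ∈ U, ∀ s, Real.exp s * ‖D y‖ < r → Φ s y = e.symm (Real.exp s • D y) := by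
    rintro y ⟨t, ht, htr⟩ s hs
    -- These times form an interval, on which `Φ` and the lift through `e.symm` are two lifts of the
    -- same ray agreeing at `t`.
    let S : Set ℝ := {a | Real.exp a * ‖D y‖ < r}
    have hS : S.OrdConnected := ⟨fun a ha b hb c hc => lt_of_le_of_lt
      (mul_le_mul_of_nonneg_right (Real.exp_le_exp.2 hc.2) (norm_nonneg _)) hb⟩
    have hcS : ContinuousOn (fun a : ℝ => e.symm (Real.exp a • D y)) S :=
      e.continuousOn_symm.comp (by fun_prop) fun a ha => hball (hmem a _ ha)
    refine flowLift_unique hD.isLocalHomeomorph hS.isPreconnected (hΦt y).continuousOn hcS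
      (fun a ha => ?_) (a := t) htr ?_ hs
    · rw [hΦD, ← heD' (e.symm _), e.right_inv (hball (hmem a _ ha))]
    · rw [← hΦD, ← heD', e.left_inv ht]
  have hsmall : ∀ y, ∃ s, Real.exp s * ‖D y‖ < r := by
    intro y
    have : Tendsto (fun s => Real.exp s * ‖D y‖) atBot (𝓝 (0 * ‖D y‖)) :=
      Real.tendsto_exp_atBot.mul_const _
    rw [zero_mul] at this
    exact (this.eventually (gt_mem_nhds hr)).exists
  have hDc := hD.isLocalHomeomorph.continuous
  have hopen : ∀ s, IsOpen {y | Real.exp s * ‖D y‖ < r} := fun s =>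
    isOpen_lt (by fun_prop) continuous_const
  have hUo : IsOpen U := by
    have : U = ⋃ t, (fun y => Φ t y) ⁻¹' e.source ∩ {y | Real.exp t * ‖D y‖ < r} := by
      ext y
      simp [U]
    rw [this]
    exact isOpen_iUnion fun t => (e.open_source.preimage (hΦx t)).inter (hopen t)
  have hUc : IsClosed U := by
    rw [← isOpen_compl_iff, isOpen_iff_mem_nhds]
    intro y hy
    obtain ⟨s, hs⟩ := hsmall y
    -- Outside `U` the flow and the `e.symm` lift differ at a time `s` when the image is in the
    -- ball. This persists nearby, while `key` forces agreement on `U`.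
    have hne : Φ s y ≠ e.symm (Real.exp s • D y) := fun heq => by
      refine hy ⟨s, ?_, hs⟩
      rw [heq]
      exact e.map_target (hball (hmem s _ hs))
    have hc1 : ContinuousAt (fun y => e.symm (Real.exp s • D y)) y :=
      ContinuousAt.comp (e.continuousAt_symm (hball (hmem s _ hs))) (by fun_prop)
    have hev : ∀ᶠ y' in 𝓝 y, (Φ s y', e.symm (Real.exp s • D y')) ∈ (diagonal (ℝ × ℝ))ᶜ :=
      ((hΦx s).continuousAt.prodMk hc1).eventually (isClosed_diagonal.isOpen_compl.mem_nhds hne)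
    filter_upwards [hev, (hopen s).mem_nhds hs] with y' hy' hs' hU'
    exact hy' (key y' hU' s hs')
  have hxU : x ∈ U := ⟨0, by rwa [hΦ0], by simpa [hp] using hr⟩
  have hU : U = univ := IsClopen.eq_univ ⟨hUc, hUo⟩ ⟨x, hxU⟩
  have hfix : latticeShift (1, 0) x = x := by
    have hD0 : D (latticeShift (1, 0) x) = 0 := by rw [hD.apply_latticeShift, hp, h0]
    have h1 := key _ (hU ▸ mem_univ (latticeShift (1, 0) x)) 0 (by simpa [hD0] using hr)
    have h2 := key _ hxU 0 (by simpa [hp] using hr)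
    rw [hΦ0, hD0] at h1
    rw [hΦ0, hp] at h2
    rw [h1, ← h2]
  have := latticeShift_eq_self hfix
  simp at this

/-! ### Logarithmic polar coordinates -/

/-- The covering projection of the punctured plane, on the coordinate plane. -/
noncomputable def polarMap (p : ℝ × ℝ) : AffPlane := PuncturedPlaneCover.dev p

theorem polarMap_zero (p : ℝ × ℝ) : polarMap p 0 = Real.exp p.1 * Real.cos p.2 := rfl

theorem polarMap_one (p : ℝ × ℝ) : polarMap p 1 = Real.exp p.1 * Real.sin p.2 := rfl

theorem polarMap_add_fst (p : ℝ × ℝ) (t : ℝ) :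
    polarMap (p.1 + t, p.2) = Real.exp t • polarMap p := by
  rw [AffPlane.ext_iff]
  simp only [polarMap_zero, polarMap_one, PiLp.smul_apply, smul_eq_mul, Real.exp_add]
  constructor <;> ring

theorem polarMap_ne_zero (p : ℝ × ℝ) : polarMap p ≠ 0 := PuncturedPlaneCover.dev_ne_zero p

theorem isLocalHomeomorph_polarMap : IsLocalHomeomorph polarMap :=
  PuncturedPlaneCover.isLocalHomeomorph_dev

theorem isCoveringMap_polarMap :
    IsCoveringMap fun p : ℝ × ℝ => (⟨polarMap p, polarMap_ne_zero p⟩ : {z : AffPlane // z ≠ 0}) :=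
  PuncturedPlaneCover.isCoveringMap_proj

theorem exists_polar_lift {D : ℝ × ℝ → AffPlane} (hD : Continuous D) (h0 : ∀ x, D x ≠ 0) :
    ∃ F : ℝ × ℝ → ℝ × ℝ, Continuous F ∧ ∀ x, polarMap (F x) = D x := by
  obtain ⟨p, hp⟩ := PuncturedPlaneCover.surjective_proj ⟨D 0, h0 0⟩
  obtain ⟨F, ⟨-, hF⟩, -⟩ := isCoveringMap_polarMap.existsUnique_continuousMap_lifts
    ⟨fun x => ⟨D x, h0 x⟩, hD.subtype_mk _⟩ 0 p hp
  exact ⟨F, F.continuous, fun x => congrArg Subtype.val (congrFun hF x)⟩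

/-- Scaling by `exp t` is translation of the logarithmic radius, and lifts through the covering
`polarMap` are unique. The homothety flow thus becomes the horizontal flow. -/
theorem polar_lift_of_homothety {c : ℝ → ℝ × ℝ} (hc : Continuous c)
    (h : ∀ t, polarMap (c t) = Real.exp t • polarMap (c 0)) (t : ℝ) :
    c t = ((c 0).1 + t, (c 0).2) := by
  have := isCoveringMap_polarMap.eq_of_comp_eq (g₁ := c) (g₂ := fun t => ((c 0).1 + t, (c 0).2))
    hc (by fun_prop) (by
      ext1 t
      apply Subtype.ext
      change polarMap (c t) = polarMap ((c 0).1 + t, (c 0).2)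
      rw [h, polarMap_add_fst]) 0 (by simp)
  exact congrFun this t

theorem polarMap_cross (p p' : ℝ × ℝ) :
    polarMap p 0 * polarMap p' 1 - polarMap p 1 * polarMap p' 0 =
      Real.exp (p.1 + p'.1) * Real.sin (p'.2 - p.2) := by
  simp only [polarMap_zero, polarMap_one, Real.exp_add, Real.sin_sub]
  ring

/-- Equal vectors have zero cross product, so the sine of the angle difference vanishes; within
`(-π, π)` the difference is then `0`. -/
theorem polarMap_injOn {p p' : ℝ × ℝ} (h : polarMap p = polarMap p') (h1 : -Real.pi < p'.2 - p.2)
    (h2 : p'.2 - p.2 < Real.pi) : p = p' := by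
  have hc := polarMap_cross p p'
  rw [h] at hc
  have hs : Real.sin (p'.2 - p.2) = 0 := by
    have : Real.exp (p.1 + p'.1) * Real.sin (p'.2 - p.2) = 0 := by rw [← hc]; ring
    exact (mul_eq_zero.1 this).resolve_left (Real.exp_pos _).ne'
  have hθ : p.2 = p'.2 := by
    have := (Real.sin_eq_zero_iff_of_lt_of_lt h1 h2).1 hs
    linarith
  obtain ⟨k0, k1⟩ := AffPlane.ext_iff.1 h
  simp only [polarMap_zero, polarMap_one, hθ] at k0 k1
  have he : Real.exp p.1 = Real.exp p'.1 := by
    linear_combination Real.cos p'.2 * k0 + Real.sin p'.2 * k1 -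
      (Real.exp p.1 - Real.exp p'.1) * Real.sin_sq_add_cos_sq p'.2
  exact Prod.ext (Real.exp_injective he) hθ

theorem exists_polarMap_eq (α : ℝ) {z : AffPlane}
    (hz : 0 < -Real.sin α * z 0 + Real.cos α * z 1) :
    ∃ p : ℝ × ℝ, α < p.2 ∧ p.2 < α + Real.pi ∧ polarMap p = z := by
  have hcs := Real.sin_sq_add_cos_sq α
  -- The vector `z` rotated by `-α`. It lies in the upper half-plane, so its argument is in `(0,
  -- π)`.
  set w : ℂ := ⟨Real.cos α * z 0 + Real.sin α * z 1, -Real.sin α * z 0 + Real.cos α * z 1⟩ with hw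
  have hw0 : w ≠ 0 := fun h => by
    have := congrArg Complex.im h
    rw [hw] at this
    simp only [Complex.zero_im] at this
    exact hz.ne' this
  have hn : 0 < ‖w‖ := norm_pos_iff.2 hw0
  have h1 := Complex.norm_mul_cos_arg w
  have h2 := Complex.norm_mul_sin_arg w
  have hsin : 0 < Real.sin w.arg := by
    have : 0 < ‖w‖ * Real.sin w.arg := by rw [h2]; exact hz
    exact pos_of_mul_pos_right this hn.le
  have harg0 : 0 < w.arg := by
    by_contra hneg
    exact absurd hsin (not_lt.2 (Real.sin_nonpos_of_nonpos_of_neg_pi_le (not_lt.1 hneg)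
      (Complex.neg_pi_lt_arg w).le))
  have hargpi : w.arg < Real.pi := by
    refine lt_of_le_of_ne (Complex.arg_le_pi w) fun h => ?_
    rw [h, Real.sin_pi] at hsin
    exact lt_irrefl _ hsin
  refine ⟨(Real.log ‖w‖, w.arg + α), by simpa using harg0, by simp only; linarith, ?_⟩
  rw [AffPlane.ext_iff]
  simp only [polarMap_zero, polarMap_one, Real.exp_log hn, Real.cos_add, Real.sin_add]
  change ‖w‖ * _ = Real.cos α * z 0 + Real.sin α * z 1 at h1
  change ‖w‖ * _ = -Real.sin α * z 0 + Real.cos α * z 1 at h2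
  constructor
  · linear_combination Real.cos α * h1 - Real.sin α * h2 + z 0 * hcs
  · linear_combination Real.sin α * h1 + Real.cos α * h2 + z 1 * hcs

/-- Sectors of angle at most `π`. -/
theorem isStandardDev_of_sector {D : ℝ × ℝ → AffPlane} {F : ℝ × ℝ → ℝ × ℝ}
    (hinj : Function.Injective F) (hFD : ∀ x, polarMap (F x) = D x) {α β : ℝ} (hαβ : α < β)
    (hβ : β ≤ α + Real.pi) (hrange : range F = univ ×ˢ Ioo α β) : IsStandardDev D := by
  have hmem : ∀ x, α < (F x).2 ∧ (F x).2 < β := fun x => by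
    have : F x ∈ univ ×ˢ Ioo α β := hrange ▸ mem_range_self x
    exact this.2
  have hDinj : Function.Injective D := by
    intro x y hxy
    rw [← hFD, ← hFD] at hxy
    have hx := hmem x
    have hy := hmem y
    exact hinj (polarMap_injOn hxy (by linarith) (by linarith))
  have hsub : ∀ p : ℝ × ℝ, α < p.2 → p.2 < β → polarMap p ∈ range D := by
    intro p h1 h2
    have : p ∈ range F := by rw [hrange]; exact ⟨mem_univ _, h1, h2⟩
    obtain ⟨x, rfl⟩ := this
    exact ⟨x, (hFD x).symm⟩
  have hb : ∀ p : ℝ × ℝ, -Real.sin α * polarMap p 0 + Real.cos α * polarMap p 1 =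
      Real.exp p.1 * Real.sin (p.2 - α) := fun p => by
    rw [polarMap_zero, polarMap_one, Real.sin_sub]; ring
  have ha : ∀ p : ℝ × ℝ, Real.sin β * polarMap p 0 + -Real.cos β * polarMap p 1 =
      Real.exp p.1 * Real.sin (β - p.2) := fun p => by
    rw [polarMap_zero, polarMap_one, Real.sin_sub]; ring
  rcases eq_or_lt_of_le hβ with heq | hlt
  · have hdet : Real.cos α * Real.cos α - Real.sin α * -Real.sin α ≠ 0 := by
      have : Real.cos α * Real.cos α - Real.sin α * -Real.sin α = 1 := by
        linear_combination Real.sin_sq_add_cos_sq α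
      rw [this]
      exact one_ne_zero
    set A := affOfCoords (Real.cos α) (Real.sin α) (-Real.sin α) (Real.cos α) 0 0 hdet
    have hA : ∀ z, A z 1 = -Real.sin α * z 0 + Real.cos α * z 1 := fun z => by
      rw [affOfCoords_one, add_zero]
    refine ⟨A, Or.inl ⟨hDinj, Or.inr (Or.inl ?_)⟩⟩
    ext w
    change _ ↔ 0 < w 1
    constructor
    · rintro ⟨x, rfl⟩
      change 0 < A (D x) 1
      rw [hA, ← hFD, hb]
      have := hmem x
      exact mul_pos (Real.exp_pos _) (Real.sin_pos_of_pos_of_lt_pi (by linarith) (by linarith))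
    · intro hw
      obtain ⟨p, hp1, hp2, hp⟩ := exists_polarMap_eq α (z := A.symm w) (by
        rw [← hA, AffineEquiv.apply_symm_apply]; exact hw)
      obtain ⟨x, hx⟩ := hsub p hp1 (by linarith)
      exact ⟨x, by simp [hx, hp]⟩
  · have hsin : 0 < Real.sin (β - α) :=
      Real.sin_pos_of_pos_of_lt_pi (by linarith) (by linarith)
    have hdet : Real.sin β * Real.cos α - -Real.cos β * -Real.sin α ≠ 0 := by
      have : Real.sin β * Real.cos α - -Real.cos β * -Real.sin α = Real.sin (β - α) := by
        rw [Real.sin_sub]; ring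
      rw [this]
      exact hsin.ne'
    -- The two coordinates are linear forms vanishing on the edge directions `β` and `α`, with signs
    -- making both positive inside the sector.
    set A := affOfCoords (Real.sin β) (-Real.cos β) (-Real.sin α) (Real.cos α) 0 0 hdet
    have hA0 : ∀ z, A z 0 = Real.sin β * z 0 + -Real.cos β * z 1 := fun z => by
      rw [affOfCoords_zero, add_zero]
    have hA1 : ∀ z, A z 1 = -Real.sin α * z 0 + Real.cos α * z 1 := fun z => by
      rw [affOfCoords_one, add_zero]
    refine ⟨A, Or.inl ⟨hDinj, Or.inr (Or.inr ?_)⟩⟩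
    ext w
    change _ ↔ 0 < w 0 ∧ 0 < w 1
    constructor
    · rintro ⟨x, rfl⟩
      change 0 < A (D x) 0 ∧ 0 < A (D x) 1
      rw [hA0, hA1, ← hFD, ha, hb]
      have := hmem x
      exact ⟨mul_pos (Real.exp_pos _) (Real.sin_pos_of_pos_of_lt_pi (by linarith) (by linarith)),
        mul_pos (Real.exp_pos _) (Real.sin_pos_of_pos_of_lt_pi (by linarith) (by linarith))⟩
    · rintro ⟨hw0, hw1⟩
      obtain ⟨p, hp1, hp2, hp⟩ := exists_polarMap_eq α (z := A.symm w) (by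
        rw [← hA1, AffineEquiv.apply_symm_apply]; exact hw1)
      have h3 : 0 < Real.exp p.1 * Real.sin (β - p.2) := by
        rw [← ha, hp, ← hA0, AffineEquiv.apply_symm_apply]
        exact hw0
      have h4 : 0 < Real.sin (β - p.2) := pos_of_mul_pos_right h3 (Real.exp_pos _).le
      have h5 : p.2 < β := by
        by_contra hneg
        exact absurd h4 (not_lt.2 (Real.sin_nonpos_of_nonpos_of_neg_pi_le (by linarith)
          (by linarith)))
      obtain ⟨x, hx⟩ := hsub p hp1 h5
      exact ⟨x, by simp [hx, hp]⟩

/-! ### Linear holonomy in polar coordinates -/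

/-- `F` is an equivariant polar lift of a developing map, with image the strip over `J`, of a torus
whose holonomy `h` fixes the origin. -/
structure IsPolarDev (F : ℝ × ℝ → ℝ × ℝ) (h : ℤ × ℤ → AffPlane ≃ᵃ[ℝ] AffPlane) (J : Set ℝ) :
    Prop where
  isLocalHomeomorph : IsLocalHomeomorph F
  injective : Function.Injective F
  range_eq : range F = univ ×ˢ J
  isOpen : IsOpen J
  ordConnected : J.OrdConnected
  fix_zero : ∀ γ, h γ 0 = 0
  polarMap_latticeShift : ∀ γ x, polarMap (F (latticeShift γ x)) = h γ (polarMap (F x))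

namespace IsPolarDev

variable {F : ℝ × ℝ → ℝ × ℝ} {h : ℤ × ℤ → AffPlane ≃ᵃ[ℝ] AffPlane} {J : Set ℝ}

theorem snd_mem (hF : IsPolarDev F h J) (x : ℝ × ℝ) : (F x).2 ∈ J := by
  have : F x ∈ univ ×ˢ J := hF.range_eq ▸ mem_range_self x
  exact this.2

theorem exists_inverse (hF : IsPolarDev F h J) : ∃ σ : ℝ × ℝ → ℝ × ℝ,
    ContinuousOn σ (univ ×ˢ J) ∧ (∀ x, σ (F x) = x) ∧ ∀ z, z.2 ∈ J → F (σ z) = z := by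
  have hemb := hF.isLocalHomeomorph.isOpenEmbedding_of_injective hF.injective
  let e := hemb.toOpenPartialHomeomorph
  have he : e.target = univ ×ˢ J := by
    rw [← hF.range_eq]
    exact hemb.toOpenPartialHomeomorph_target
  refine ⟨e.symm, he ▸ e.continuousOn_symm, fun x => e.left_inv (by simp [e]), fun z hz => ?_⟩
  exact e.right_inv (he ▸ ⟨mem_univ _, hz⟩)

/-- The deck transformations commute with the radial flow. -/
theorem latticeShift_ray (hF : IsPolarDev F h J) (γ : ℤ × ℤ) {x y : ℝ × ℝ}
    (hxy : (F x).2 = (F y).2) : F (latticeShift γ y) =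
      ((F (latticeShift γ x)).1 + ((F y).1 - (F x).1), (F (latticeShift γ x)).2) := by
  obtain ⟨σ, hσc, hσF, hFσ⟩ := hF.exists_inverse
  have hc : Continuous fun t : ℝ => F (latticeShift γ (σ ((F x).1 + t, (F x).2))) := by
    refine hF.isLocalHomeomorph.continuous.comp ((latticeShift γ).continuous.comp ?_)
    exact hσc.comp_continuous (by fun_prop) fun t => ⟨mem_univ _, hF.snd_mem x⟩
  have h0 : σ ((F x).1 + 0, (F x).2) = x := by simp [hσF]
  have h1 : σ ((F x).1 + ((F y).1 - (F x).1), (F x).2) = y := by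
    rw [add_sub_cancel, hxy]
    exact hσF y
  -- Since `h γ` is linear, the transported radial line is again a polar lift of a homothety orbit.
  have := polar_lift_of_homothety hc (fun t => by
    rw [h0, hF.polarMap_latticeShift, hF.polarMap_latticeShift,
      hFσ ((F x).1 + t, (F x).2) (hF.snd_mem x), polarMap_add_fst, (h γ).map_smul_of_fix_zero (hF.fix_zero γ)]) ((F y).1 - (F x).1)
  simp only [h0, h1] at this
  exact this

/-- The action of a deck transformation on directions. -/
theorem exists_angle_map (hF : IsPolarDev F h J) (γ : ℤ × ℤ) : ∃ v : ℝ → ℝ, ContinuousOn v J ∧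
    (∀ θ ∈ J, v θ ∈ J) ∧ ∀ x, (F (latticeShift γ x)).2 = v (F x).2 := by
  obtain ⟨σ, hσc, hσF, hFσ⟩ := hF.exists_inverse
  refine ⟨fun θ => (F (latticeShift γ (σ (0, θ)))).2, ?_, fun θ _ => hF.snd_mem _, fun x => ?_⟩
  · refine (continuous_snd.comp (hF.isLocalHomeomorph.continuous.comp
      (latticeShift γ).continuous)).comp_continuousOn ?_
    exact hσc.comp (by fun_prop) fun θ hθ => ⟨mem_univ _, hθ⟩
  · rw [hF.latticeShift_ray γ (x := σ (0, (F x).2)) (y := x)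
      (by rw [hFσ (0, (F x).2) (hF.snd_mem x)])]

/-- The squares of the deck transformations preserve the orientation. -/
theorem exists_cross_eq (hF : IsPolarDev F h J) (γ : ℤ × ℤ) : ∃ k > 0, ∀ x y : ℝ × ℝ,
    Real.exp ((F (latticeShift (γ + γ) x)).1 + (F (latticeShift (γ + γ) y)).1) *
      Real.sin ((F (latticeShift (γ + γ) y)).2 - (F (latticeShift (γ + γ) x)).2) =
    k * (Real.exp ((F x).1 + (F y).1) * Real.sin ((F y).2 - (F x).2)) := by
  obtain ⟨a, b, c, d, hh0, hh1⟩ : ∃ a b c d : ℝ, (∀ z, h γ z 0 = a * z 0 + b * z 1) ∧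
      ∀ z, h γ z 1 = c * z 0 + d * z 1 := by
    refine ⟨(h γ).linear !₂[1, 0] 0, (h γ).linear !₂[0, 1] 0, (h γ).linear !₂[1, 0] 1,
      (h γ).linear !₂[0, 1] 1, fun z => ?_, fun z => ?_⟩ <;>
    · rw [(h γ).apply_eq_linear_add, hF.fix_zero, add_zero]
      exact ((h γ).linear.toLinearMap).affPlane_coord z _
  have hdet : a * d - b * c ≠ 0 := by
    intro hdet
    have k1 : h γ !₂[d, -c] = 0 := by
      rw [AffPlane.ext_iff, hh0, hh1]
      simp only [Matrix.cons_val_zero, Matrix.cons_val_one, PiLp.zero_apply]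
      constructor <;> linarith
    have k2 : h γ !₂[-b, a] = 0 := by
      rw [AffPlane.ext_iff, hh0, hh1]
      simp only [Matrix.cons_val_zero, Matrix.cons_val_one, PiLp.zero_apply]
      constructor <;> linarith
    have k1' := AffPlane.ext_iff.1 ((h γ).injective (k1.trans (hF.fix_zero γ).symm))
    have k2' := AffPlane.ext_iff.1 ((h γ).injective (k2.trans (hF.fix_zero γ).symm))
    simp at k1' k2'
    have k3 : h γ !₂[1, 0] = 0 := by
      rw [AffPlane.ext_iff, hh0, hh1]
      simp [k1'.2, k2'.2]
    have k3' := AffPlane.ext_iff.1 ((h γ).injective (k3.trans (hF.fix_zero γ).symm))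
    simp at k3'
  -- A linear map multiplies cross products by its determinant; applying `h γ` twice squares it,
  -- which makes the factor positive whatever the orientation.
  refine ⟨(a * d - b * c) ^ 2, by positivity, fun x y => ?_⟩
  rw [← polarMap_cross, ← polarMap_cross]
  have hz : ∀ x, polarMap (F (latticeShift (γ + γ) x)) = h γ (h γ (polarMap (F x))) := fun x => by
    rw [latticeShift_add, hF.polarMap_latticeShift, hF.polarMap_latticeShift]
  simp only [hz, hh0, hh1]
  ring

/-- An interval bounded below of length more than `π` would contain an invariant direction. -/
theorem sInf_add_pi_notMem (hF : IsPolarDev F h J) (hbdd : BddBelow J) :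
    sInf J + Real.pi ∉ J := by
  intro hmem
  set α := sInf J with hα
  have hpi := Real.pi_pos
  have hαJ : ∀ θ ∈ J, α < θ := by
    intro θ hθ
    obtain ⟨ε, hε, hball⟩ := Metric.isOpen_iff.1 hF.isOpen θ hθ
    have h1 : θ - ε / 2 ∈ J := hball (by
      rw [Real.ball_eq_Ioo]; constructor <;> linarith)
    have := csInf_le hbdd h1
    linarith
  have hJα : ∀ θ, α < θ → θ ≤ α + Real.pi → θ ∈ J := by
    intro θ h1 h2
    obtain ⟨θ', hθ', hlt⟩ := exists_lt_of_csInf_lt ⟨_, hmem⟩ h1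
    exact hF.ordConnected.out hθ' hmem ⟨hlt.le, h2⟩
  have hsurj : ∀ θ ∈ J, ∃ x, F x = (0, θ) := fun θ hθ => by
    have : ((0 : ℝ), θ) ∈ range F := by rw [hF.range_eq]; exact ⟨mem_univ _, hθ⟩
    exact this
  choose v hvc hvJ hvF using fun γ => hF.exists_angle_map (γ + γ)
  have hcross : ∀ γ, ∀ θ ∈ J, ∀ θ' ∈ J, ∃ k > 0, Real.sin (v γ θ' - v γ θ) =
      k * Real.sin (θ' - θ) := by
    intro γ θ hθ θ' hθ'
    obtain ⟨k, hk, hkF⟩ := hF.exists_cross_eq γ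
    obtain ⟨x, hx⟩ := hsurj θ hθ
    obtain ⟨y, hy⟩ := hsurj θ' hθ'
    have h1 := hkF x y
    rw [hvF, hvF, hx, hy] at h1
    set E := Real.exp ((F (latticeShift (γ + γ) x)).1 + (F (latticeShift (γ + γ) y)).1)
    have hE : 0 < E := Real.exp_pos _
    refine ⟨E⁻¹ * k, by positivity, ?_⟩
    simp only [add_zero, Real.exp_zero, one_mul] at h1
    rw [mul_assoc, ← h1, inv_mul_cancel_left₀ hE.ne']
  -- For angles less than `π` apart the sine of the difference of images stays positive. By the
  -- intermediate value theorem the difference starts at `0` and can reach neither `π` nor `-π`.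
  have hmono : ∀ γ, ∀ θ ∈ J, ∀ θ' ∈ J, θ < θ' → θ' < θ + Real.pi →
      0 < v γ θ' - v γ θ ∧ v γ θ' - v γ θ < Real.pi := by
    intro γ θ hθ θ' hθ' h1 h2
    have hsub : Icc θ θ' ⊆ J := hF.ordConnected.out hθ hθ'
    have hpos : ∀ t ∈ Ioc θ θ', 0 < Real.sin (v γ t - v γ θ) := by
      intro t ht
      obtain ⟨k, hk, hke⟩ := hcross γ θ hθ t (hsub ⟨ht.1.le, ht.2⟩)
      rw [hke]
      exact mul_pos hk (Real.sin_pos_of_pos_of_lt_pi (by linarith [ht.1]) (by linarith [ht.2]))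
    have hcont : ContinuousOn (fun t => v γ t - v γ θ) (Icc θ θ') :=
      ((hvc γ).mono hsub).sub continuousOn_const
    have hpos' := hpos θ' ⟨h1, le_rfl⟩
    constructor
    · by_contra hneg
      have hlt : v γ θ' - v γ θ ≤ -Real.pi := by
        by_contra hgt
        exact absurd hpos' (not_lt.2 (Real.sin_nonpos_of_nonpos_of_neg_pi_le (not_lt.1 hneg)
          (not_le.1 hgt).le))
      obtain ⟨t, ht, hte⟩ := intermediate_value_Icc' h1.le hcont
        (show -Real.pi ∈ Icc (v γ θ' - v γ θ) (v γ θ - v γ θ) from ⟨hlt, by simp [hpi.le]⟩)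
      simp only at hte
      have htθ : t ≠ θ := by
        rintro rfl
        simp at hte
      have := hpos t ⟨lt_of_le_of_ne ht.1 (Ne.symm htθ), ht.2⟩
      rw [hte] at this
      simp at this
    · by_contra hge
      obtain ⟨t, ht, hte⟩ := intermediate_value_Icc h1.le hcont
        (show Real.pi ∈ Icc (v γ θ - v γ θ) (v γ θ' - v γ θ) from
          ⟨by simp [hpi.le], not_lt.1 hge⟩)
      simp only at hte
      have htθ : t ≠ θ := by
        rintro rfl
        simp at hte
        exact hpi.ne hte
      have := hpos t ⟨lt_of_le_of_ne ht.1 (Ne.symm htθ), ht.2⟩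
      rw [hte] at this
      simp at this
  -- Splitting at `θ + π / 2` puts the difference of images in `(0, 2π)`. Its sine is zero, so it
  -- equals `π`.
  have hperiod : ∀ γ θ, θ ∈ J → θ + Real.pi ∈ J → v γ (θ + Real.pi) = v γ θ + Real.pi := by
    intro γ θ hθ hθ'
    have hm : θ + Real.pi / 2 ∈ J := hF.ordConnected.out hθ hθ' ⟨by linarith, by linarith⟩
    have h1 := hmono γ θ hθ _ hm (by linarith) (by linarith)
    have h2 := hmono γ _ hm _ hθ' (by linarith) (by linarith)
    obtain ⟨k, -, hk⟩ := hcross γ θ hθ _ hθ'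
    rw [add_sub_cancel_left, Real.sin_pi, mul_zero] at hk
    have h3 : Real.sin (v γ (θ + Real.pi) - v γ θ - Real.pi) = 0 := by
      rw [Real.sin_sub_pi, hk, neg_zero]
    have h4 := (Real.sin_eq_zero_iff_of_lt_of_lt (by linarith [h1.1, h2.1])
      (by linarith [h1.2, h2.2])).1 h3
    linarith
  -- Such an angle is `π` plus an element of `J`, whose image in `J` exceeds `α`; by `hperiod` the
  -- image of the angle then exceeds `α + π`.
  have hgt : ∀ γ, ∀ θ ∈ J, α + Real.pi < θ → α + Real.pi < v γ θ := by
    intro γ θ hθ hlt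
    have hθ' : θ - Real.pi ∈ J := by
      by_cases hle : θ - Real.pi ≤ α + Real.pi
      · exact hJα _ (by linarith) hle
      · exact hF.ordConnected.out hmem hθ ⟨(not_le.1 hle).le, by linarith⟩
    have h1 := hperiod γ (θ - Real.pi) hθ' (by simpa using hθ)
    rw [sub_add_cancel] at h1
    have h2 := hαJ _ (hvJ γ _ hθ')
    linarith
  have hge : ∀ γ, α + Real.pi ≤ v γ (α + Real.pi) := by
    intro γ
    have hc : ContinuousAt (v γ) (α + Real.pi) :=
      (hvc γ).continuousAt (hF.isOpen.mem_nhds hmem)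
    refine ge_of_tendsto (hc.tendsto.mono_left (nhdsWithin_le_nhds (s := Ioi (α + Real.pi)))) ?_
    filter_upwards [self_mem_nhdsWithin, nhdsWithin_le_nhds (hF.isOpen.mem_nhds hmem)]
      with θ h1 h2
    exact (hgt γ θ h2 h1).le
  have hinv : ∀ γ, ∀ θ ∈ J, v γ (v (-γ) θ) = θ := by
    intro γ θ hθ
    obtain ⟨x, hx⟩ := hsurj θ hθ
    have h1 : (F x).2 = θ := by rw [hx]
    rw [← h1, ← hvF (-γ) x, ← hvF γ, ← latticeShift_add,
      show γ + γ + (-γ + -γ) = 0 by abel, latticeShift_zero]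
  -- By continuity `α + π` is never moved down. If `γ` moved it strictly up, the inverse would send
  -- that image back to `α + π`, against `hgt`.
  have hfix : ∀ γ, v γ (α + Real.pi) = α + Real.pi := by
    intro γ
    by_contra hne
    have hlt : α + Real.pi < v γ (α + Real.pi) := lt_of_le_of_ne (hge γ) (Ne.symm hne)
    have h1 := hgt (-γ) _ (hvJ γ _ hmem) hlt
    have h2 := hinv (-γ) _ hmem
    rw [neg_neg] at h2
    rw [h2] at h1
    exact lt_irrefl _ h1
  obtain ⟨p, hp⟩ := hsurj _ hmem
  refine not_latticeShift_preserves_line hF.isLocalHomeomorph hF.injective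
    (y₀ := α + Real.pi) ⟨p, by rw [hp]⟩ (fun γ => (F (latticeShift (γ + γ) p)).1) fun γ x hx => ?_
  rw [hF.latticeShift_ray (γ + γ) (x := p) (y := x) (by rw [hp, hx]), hvF, hp]
  simp only [hfix, sub_zero]
  rw [add_comm]

/-- The excluded angle `sInf J + π` caps the interval, so `J` is an open interval of length at most
`π` and the image is a sector. -/
theorem isStandardDev_of_bddBelow {D : ℝ × ℝ → AffPlane} (hF : IsPolarDev F h J)
    (hFD : ∀ x, polarMap (F x) = D x) (hbdd : BddBelow J) : IsStandardDev D := by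
  have hne : J.Nonempty := ⟨_, hF.snd_mem 0⟩
  have hnot := hF.sInf_add_pi_notMem hbdd
  have hmem : ∀ θ ∈ J, sInf J < θ ∧ θ < sInf J + Real.pi := by
    intro θ hθ
    obtain ⟨ε, hε, hball⟩ := Metric.isOpen_iff.1 hF.isOpen θ hθ
    have h1 : θ - ε / 2 ∈ J := hball (by
      rw [Real.ball_eq_Ioo]; constructor <;> linarith)
    have h2 := csInf_le hbdd h1
    refine ⟨by linarith, ?_⟩
    by_contra hge
    obtain ⟨θ', hθ', hlt⟩ := exists_lt_of_csInf_lt hne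
      (show sInf J < sInf J + Real.pi by linarith [Real.pi_pos])
    exact hnot (hF.ordConnected.out hθ' hθ ⟨hlt.le, not_lt.1 hge⟩)
  have hba : BddAbove J := ⟨_, fun θ hθ => (hmem θ hθ).2.le⟩
  have hJ : J = Ioo (sInf J) (sSup J) := by
    ext θ
    constructor
    · intro hθ
      obtain ⟨ε, hε, hball⟩ := Metric.isOpen_iff.1 hF.isOpen θ hθ
      have h1 : θ + ε / 2 ∈ J := hball (by
        rw [Real.ball_eq_Ioo]; constructor <;> linarith)
      have h2 := le_csSup hba h1
      exact ⟨(hmem θ hθ).1, by linarith⟩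
    · rintro ⟨h1, h2⟩
      obtain ⟨a, ha, ha'⟩ := exists_lt_of_csInf_lt hne h1
      obtain ⟨b, hb, hb'⟩ := exists_lt_of_lt_csSup hne h2
      exact hF.ordConnected.out ha hb ⟨ha'.le, hb'.le⟩
  have hlt : sInf J < sSup J := by
    obtain ⟨θ, hθ⟩ := hne
    exact (hmem θ hθ).1.trans_le (le_csSup hba hθ)
  exact isStandardDev_of_sector hF.injective hFD hlt
    (csSup_le hne fun θ hθ => (hmem θ hθ).2.le) (by rw [hF.range_eq, ← hJ])

end IsPolarDev

/-- The reflection `(x, y) ↦ (x, -y)`. -/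
noncomputable def affReflection : AffPlane ≃ᵃ[ℝ] AffPlane := affOfCoords 1 0 0 (-1) 0 0 (by norm_num)

theorem affReflection_polarMap (p : ℝ × ℝ) : affReflection (polarMap p) = polarMap (p.1, -p.2) := by
  rw [AffPlane.ext_iff, affReflection, affOfCoords_zero, affOfCoords_one]
  simp [polarMap_zero, polarMap_one]

theorem affReflection_zero : affReflection 0 = 0 := by
  rw [AffPlane.ext_iff, affReflection, affOfCoords_zero, affOfCoords_one]
  simp

/-- Reverses the angle, so that an upper bound on `J` becomes a lower bound. -/
theorem IsPolarDev.reflect {F : ℝ × ℝ → ℝ × ℝ} {h : ℤ × ℤ → AffPlane ≃ᵃ[ℝ] AffPlane} {J : Set ℝ}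
    (hF : IsPolarDev F h J) : IsPolarDev (fun x => ((F x).1, -(F x).2))
      (fun γ => affReflection.symm.trans ((h γ).trans affReflection)) (Neg.neg ⁻¹' J) := by
  let e : ℝ × ℝ ≃ₜ ℝ × ℝ := (Homeomorph.refl ℝ).prodCongr (Homeomorph.neg ℝ)
  have he : ∀ p, e p = (p.1, -p.2) := fun p => rfl
  refine ⟨e.isLocalHomeomorph.comp hF.isLocalHomeomorph, e.injective.comp hF.injective, ?_,
    hF.isOpen.preimage continuous_neg, ?_, fun γ => ?_, fun γ x => ?_⟩
  · ext z
    have : z ∈ range (fun x => ((F x).1, -(F x).2)) ↔ (z.1, -z.2) ∈ range F := by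
      constructor
      · rintro ⟨x, rfl⟩
        exact ⟨x, by simp⟩
      · rintro ⟨x, hx⟩
        exact ⟨x, by simp [hx]⟩
    rw [this, hF.range_eq]
    rfl
  · exact ((Homeomorph.neg ℝ).isPreconnected_preimage.2
      hF.ordConnected.isPreconnected).ordConnected
  · have h1 : affReflection.symm 0 = 0 := by
      rw [← affReflection.injective.eq_iff, AffineEquiv.apply_symm_apply, affReflection_zero]
    simp [h1, hF.fix_zero, affReflection_zero]
  · rw [← affReflection_polarMap, ← affReflection_polarMap, hF.polarMap_latticeShift]
    simp

theorem IsPolarDev.isStandardDev {F : ℝ × ℝ → ℝ × ℝ} {h : ℤ × ℤ → AffPlane ≃ᵃ[ℝ] AffPlane}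
    {J : Set ℝ} {D : ℝ × ℝ → AffPlane} (hF : IsPolarDev F h J)
    (hFD : ∀ x, polarMap (F x) = D x) : IsStandardDev D := by
  by_cases hb : BddBelow J
  · exact hF.isStandardDev_of_bddBelow hFD hb
  by_cases ha : BddAbove J
  · refine IsStandardDev.of_comp affReflection (hF.reflect.isStandardDev_of_bddBelow
      (fun x => by rw [← affReflection_polarMap, hFD]) ?_)
    obtain ⟨B, hB⟩ := ha
    refine ⟨-B, fun θ hθ => ?_⟩
    have := hB (show -θ ∈ J from hθ)
    linarith
  · have hJ : J = univ := by
      refine eq_univ_of_forall fun θ => ?_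
      obtain ⟨a, haJ, haθ⟩ := not_bddBelow_iff.1 hb θ
      obtain ⟨b, hbJ, hbθ⟩ := not_bddAbove_iff.1 ha θ
      exact hF.ordConnected.out haJ hbJ ⟨haθ.le, hbθ.le⟩
    have hbij : Function.Bijective F := by
      refine ⟨hF.injective, fun z => ?_⟩
      have : z ∈ range F := by rw [hF.range_eq, hJ]; exact ⟨mem_univ _, mem_univ _⟩
      exact this
    refine ⟨AffineEquiv.refl ℝ AffPlane, Or.inr
      ⟨hF.isLocalHomeomorph.toHomeomorphOfBijective hbij, fun x => ?_⟩⟩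
    exact hFD x

/-- As `D` misses the origin, it lifts to logarithmic polar coordinates. There the lifted homothety
flow is horizontal, and the strip theorem applies to the lift. -/
theorem IsTorusDev.isStandardDev_of_fix_zero {D : ℝ × ℝ → AffPlane}
    {h : ℤ × ℤ → AffPlane ≃ᵃ[ℝ] AffPlane} (hD : IsTorusDev D h) (h0 : ∀ γ, h γ 0 = 0) :
    IsStandardDev D := by
  obtain ⟨F, hFc, hFD⟩ := exists_polar_lift hD.isLocalHomeomorph.continuous (hD.ne_zero h0)
  obtain ⟨Φ, hΦc, hΦ0, hΦD⟩ := hD.exists_lift_flow isFlow_homothety (fun γ t z =>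
    ((h γ).map_smul_of_fix_zero (h0 γ) _ _).symm)
  have hF : IsLocalHomeomorph F := by
    refine IsLocalHomeomorph.of_comp (g := polarMap) ?_ isLocalHomeomorph_polarMap hFc
    rw [show polarMap ∘ F = D from funext hFD]
    exact hD.isLocalHomeomorph
  obtain ⟨hinj, J, hJo, hJc, -, hJr⟩ := injective_and_range_of_horizontal_flow hF hΦc hΦ0
    (fun t x => by
      have := polar_lift_of_homothety (c := fun t => F (Φ t x))
        (hFc.comp (hΦc.comp (Continuous.prodMk_left x))) (fun t => by
          rw [hFD, hFD, hΦD, hΦ0]) t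
      simpa only [hΦ0] using this)
  exact IsPolarDev.isStandardDev (h := h) (J := J) ⟨hF, hinj, hJr, hJo, hJc, h0, fun γ x => by
    rw [hFD, hFD, hD.apply_latticeShift]⟩ hFD

theorem IsTorusDev.isStandardDev {D : ℝ × ℝ → AffPlane}
    {h : ℤ × ℤ → AffPlane ≃ᵃ[ℝ] AffPlane} (hD : IsTorusDev D h) : IsStandardDev D := by
  rcases exists_fixed_point_or_vector h hD.comm (fun γ γ' => ⟨γ + γ', hD.apply_add γ γ'⟩) with
    ⟨z, hz⟩ | ⟨v, hv, hfix⟩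
  · let A : AffPlane ≃ᵃ[ℝ] AffPlane := AffineEquiv.constVAdd ℝ AffPlane (-z)
    have hA : A z = 0 := by simp [A]
    have hA' : A.symm 0 = z := by rw [← hA, AffineEquiv.symm_apply_apply]
    refine IsStandardDev.of_comp A ((hD.comp A).isStandardDev_of_fix_zero fun γ => ?_)
    simp only [AffineEquiv.trans_apply, hA', hz, hA]
  · exact hD.isStandardDev_of_fixed_vector hv hfix

/-! ### The model domains -/

theorem image_eq_of_mem_iff {Ω : Set AffPlane} {A : AffPlane ≃ᵃ[ℝ] AffPlane}
    (h : ∀ z, A z ∈ Ω ↔ z ∈ Ω) : A '' Ω = Ω := by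
  ext w
  constructor
  · rintro ⟨z, hz, rfl⟩
    exact (h z).2 hz
  · intro hw
    exact ⟨A.symm w, (h _).1 (by simpa using hw), by simp⟩

theorem isSimplyConnected_of_convex {Ω : Set AffPlane} (hΩ : Convex ℝ Ω) (hne : Ω.Nonempty) :
    IsSimplyConnected Ω := by
  have := hΩ.contractibleSpace hne
  exact SimplyConnectedSpace.ofContractible Ω

theorem convex_affHalfPlane : Convex ℝ (affHalfPlane : Set AffPlane) := by
  intro z hz w hw a b ha hb hab
  have hz : 0 < z 1 := hz
  have hw : 0 < w 1 := hw
  change 0 < (a • z + b • w) 1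
  simp only [PiLp.add_apply, PiLp.smul_apply, smul_eq_mul]
  rcases ha.eq_or_lt with rfl | ha
  · have : b = 1 := by linarith
    simp [this, hw]
  · positivity

theorem convex_affQuadrant : Convex ℝ (affQuadrant : Set AffPlane) := by
  intro z hz w hw a b ha hb hab
  obtain ⟨hz0, hz1⟩ : 0 < z 0 ∧ 0 < z 1 := hz
  obtain ⟨hw0, hw1⟩ : 0 < w 0 ∧ 0 < w 1 := hw
  change 0 < (a • z + b • w) 0 ∧ 0 < (a • z + b • w) 1
  simp only [PiLp.add_apply, PiLp.smul_apply, smul_eq_mul]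
  rcases ha.eq_or_lt with rfl | ha
  · have : b = 1 := by linarith
    simp [this, hw0, hw1]
  · constructor <;> positivity

theorem nonempty_affQuadrant : (affQuadrant : Set AffPlane).Nonempty :=
  ⟨!₂[1, 1], show (0 : ℝ) < 1 ∧ (0 : ℝ) < 1 from ⟨one_pos, one_pos⟩⟩

theorem nonempty_affHalfPlane : (affHalfPlane : Set AffPlane).Nonempty :=
  ⟨!₂[1, 1], show (0 : ℝ) < 1 from one_pos⟩

theorem isHomogeneousAffDomain_top : IsHomogeneousAffDomain ⊤ := by
  refine ⟨isConnected_univ, fun x _ y _ => ⟨AffineEquiv.constVAdd ℝ AffPlane (y - x), ?_, ?_⟩⟩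
  · exact image_eq_of_mem_iff fun z => Iff.rfl
  · simp

theorem isHomogeneousAffDomain_affHalfPlane : IsHomogeneousAffDomain affHalfPlane := by
  refine ⟨(convex_affHalfPlane.isPathConnected nonempty_affHalfPlane).isConnected, ?_⟩
  intro x hx y hy
  have hx : 0 < x 1 := hx
  have hy : 0 < y 1 := hy
  have hdet : (1 : ℝ) * (y 1 / x 1) - 0 * 0 ≠ 0 := by
    have := (div_pos hy hx).ne'
    simpa using this
  refine ⟨affOfCoords 1 0 0 (y 1 / x 1) (y 0 - x 0) 0 hdet, image_eq_of_mem_iff fun z => ?_, ?_⟩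
  · change 0 < affOfCoords _ _ _ _ _ _ hdet z 1 ↔ 0 < z 1
    rw [affOfCoords_one, zero_mul, zero_add, add_zero]
    exact mul_pos_iff_of_pos_left (div_pos hy hx)
  · rw [AffPlane.ext_iff, affOfCoords_zero, affOfCoords_one]
    constructor
    · ring
    · field_simp
      ring

theorem isHomogeneousAffDomain_affQuadrant : IsHomogeneousAffDomain affQuadrant := by
  refine ⟨(convex_affQuadrant.isPathConnected nonempty_affQuadrant).isConnected, ?_⟩
  intro x hx y hy
  obtain ⟨hx0, hx1⟩ : 0 < x 0 ∧ 0 < x 1 := hx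
  obtain ⟨hy0, hy1⟩ : 0 < y 0 ∧ 0 < y 1 := hy
  have hdet : y 0 / x 0 * (y 1 / x 1) - 0 * 0 ≠ 0 := by
    have := (mul_pos (div_pos hy0 hx0) (div_pos hy1 hx1)).ne'
    rwa [mul_zero, sub_zero]
  refine ⟨affOfCoords (y 0 / x 0) 0 0 (y 1 / x 1) 0 0 hdet, image_eq_of_mem_iff fun z => ?_, ?_⟩
  · change 0 < affOfCoords _ _ _ _ _ _ hdet z 0 ∧ 0 < affOfCoords _ _ _ _ _ _ hdet z 1 ↔
      0 < z 0 ∧ 0 < z 1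
    rw [affOfCoords_zero, affOfCoords_one, zero_mul, zero_mul, zero_add, add_zero, add_zero,
      add_zero]
    exact and_congr (mul_pos_iff_of_pos_left (div_pos hy0 hx0))
      (mul_pos_iff_of_pos_left (div_pos hy1 hx1))
  · rw [AffPlane.ext_iff, affOfCoords_zero, affOfCoords_one]
    constructor <;> field_simp <;> ring

/-! ### The classification -/

section Classification

variable {M : Type u} [TopologicalSpace M] [ChartedSpace AffPlane M] [HasGroupoid M affGroupoid]
  {q : ℝ × ℝ → M} {D : ℝ × ℝ → AffPlane} {h : ℤ × ℤ → AffPlane ≃ᵃ[ℝ] AffPlane}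

/-- An injective `D` is a homeomorphism onto `Ω` that conjugates the lattice translations to
restrictions of the holonomy. -/
theorem exists_quotient_of_range_eq (hq : IsTorusCover q)
    (hDq : ∀ x, AffGerm D (fun y => chartAt AffPlane (q x) (q y)) x) (hD : IsTorusDev D h)
    (hinj : Function.Injective D) (Ω : Opens AffPlane) (hΩ : range D = Ω) :
    (∃ Γ : Subgroup (Ω ≃ₜ Ω), (∀ γ ∈ Γ, IsAffTransformationOf Ω γ) ∧ IsAffQuotientBy M Ω Γ) ∧
      UniversalAffCoverIs.{u, 0, w} M Ω := by
  have hmem : ∀ x, D x ∈ Ω := fun x => by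
    have : D x ∈ (Ω : Set AffPlane) := hΩ ▸ mem_range_self x
    exact this
  have hemb := hD.isLocalHomeomorph.isOpenEmbedding_of_injective hinj
  let F : ℝ × ℝ ≃ₜ Ω := (Equiv.ofBijective (fun x => (⟨D x, hmem x⟩ : Ω))
    ⟨fun x y hxy => hinj (congrArg Subtype.val hxy), fun z => by
      obtain ⟨x, hx⟩ : z.1 ∈ range D := hΩ ▸ z.2
      exact ⟨x, Subtype.ext hx⟩⟩).toHomeomorphOfContinuousOpen
    (hD.isLocalHomeomorph.continuous.subtype_mk _) (hemb.isOpenMap.codRestrict _)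
  have hF : ∀ x, (F x : AffPlane) = D x := fun x => rfl
  refine ⟨⟨deckGroup F, fun g hg => ?_, ?_⟩, ?_⟩
  · obtain ⟨γ, hγ⟩ := deckGroup_apply hg
    refine ⟨h γ, fun z => ?_⟩
    obtain ⟨x, rfl⟩ := F.surjective z
    rw [hγ, hF, hF, hD.apply_latticeShift]
  · exact isAffQuotientBy_deckGroup hq (isDevelopingMap_subtypeVal Ω) hDq
  · exact universalAffCoverIs_of_homeomorph hq (isDevelopingMap_subtypeVal Ω) (F := F) hDq

end Classification

theorem mainTheorem2 (M : Type u) [TopologicalSpace M] [ChartedSpace AffPlane M]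
    [HasGroupoid M affGroupoid] (hM : Nonempty (M ≃ₜ Circle × Circle)) :
    (∃ Ω : Opens AffPlane,
      IsHomogeneousAffDomain Ω ∧ IsSimplyConnected (Ω : Set AffPlane) ∧
      (Ω = ⊤ ∨ Ω = affHalfPlane ∨ Ω = affQuadrant) ∧
      (∃ Γ : Subgroup (Ω ≃ₜ Ω), (∀ γ ∈ Γ, IsAffTransformationOf Ω γ) ∧ IsAffQuotientBy M Ω Γ) ∧
      UniversalAffCoverIs.{u, 0, w} M Ω) ∨
    ((∃ Γ : Subgroup (PuncturedPlaneCover ≃ₜ PuncturedPlaneCover),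
        (∀ γ ∈ Γ, ∃ φ : Structomorph affGroupoid PuncturedPlaneCover PuncturedPlaneCover,
          φ.toHomeomorph = γ) ∧
        IsAffQuotientBy M PuncturedPlaneCover Γ) ∧
      UniversalAffCoverIs.{u, 0, w} M PuncturedPlaneCover) := by
  obtain ⟨e⟩ := hM
  obtain ⟨q, hq⟩ := exists_isTorusCover e
  obtain ⟨D₀, hD₀⟩ := exists_developing_of_isLocalHomeomorph hq.isLocalHomeomorph
  choose h hh using exists_holonomy hq hD₀
  have hdev : IsTorusDev D₀ h := ⟨isLocalHomeomorph_of_affGerm hq.isLocalHomeomorph hD₀, hh⟩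
  obtain ⟨A, hA⟩ := hdev.isStandardDev
  -- The normalizing map `A` is absorbed into the developing map, whose germs matter only up to
  -- affine transformations.
  have hDq : ∀ x, AffGerm (fun y => A (D₀ y)) (fun y => chartAt AffPlane (q x) (q y)) x :=
    fun x => (AffGerm.of_apply A D₀ x).trans (hD₀ x)
  rcases hA with ⟨hinj, hrange⟩ | ⟨F, hF⟩
  · left
    have hinj' : Function.Injective fun x => A (D₀ x) := A.injective.comp hinj
    rcases hrange with hr | hr | hr
    · exact ⟨⊤, isHomogeneousAffDomain_top,
        isSimplyConnected_of_convex convex_univ univ_nonempty, Or.inl rfl,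
        exists_quotient_of_range_eq hq hDq (hdev.comp A) hinj' ⊤ hr⟩
    · exact ⟨affHalfPlane, isHomogeneousAffDomain_affHalfPlane,
        isSimplyConnected_of_convex convex_affHalfPlane nonempty_affHalfPlane,
        Or.inr (Or.inl rfl), exists_quotient_of_range_eq hq hDq (hdev.comp A) hinj' _ hr⟩
    · exact ⟨affQuadrant, isHomogeneousAffDomain_affQuadrant,
        isSimplyConnected_of_convex convex_affQuadrant nonempty_affQuadrant,
        Or.inr (Or.inr rfl), exists_quotient_of_range_eq hq hDq (hdev.comp A) hinj' _ hr⟩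
  · right
    have hFq : ∀ x, AffGerm (fun y => PuncturedPlaneCover.dev (F y))
        (fun y => chartAt AffPlane (q x) (q y)) x := fun x => by
      simp only [hF]
      exact hDq x
    have hδ := PuncturedPlaneCover.isDevelopingMap_dev
    exact ⟨⟨deckGroup F, fun γ hγ => exists_structomorph_of_mem_deckGroup hq hδ hFq hγ,
      isAffQuotientBy_deckGroup hq hδ hFq⟩, universalAffCoverIs_of_homeomorph hq hδ hFq⟩
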